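/- Fix $p\in[1,\infty)$; all scalars are complex, all representations are unital, and $M_d$ is the algebra of complex $d\times d$ matrices. For a Banach space $E$, $L(E)$ denotes the bounded operators on $E$ with the operator norm. A representation $\rho\colon M_d\to L(E)$ \emph{has enough isometries} if there is a finite subgroup $G$ of the group of invertible elements of $M_d$ whose natural action on $\mathbb{C}^d$ is irreducible and such that $\|\rho(g)\|=1$ for all $g\in G$. A representation $\rho\colon M_d\to L(L^p(X,\mu))$, with $\mu$ $\sigma$-finite, \emph{locally has enough isometries} if there is an at most countable partition $X=\coprod_{i\in I}X_i$ into measurable sets with $\mu(X_i)>0$ such that for every $i$ the subspace $L^p(X_i,\mu)\subset L^p(X,\mu)$ is $\rho$-invariant and the representation $x\mapsto\rho(x)|_{L^p(X_i,\mu)}$ has enough isometries. For each $n\in\mathbb{N}$ let $(X_n,\mu_n)$ be a probability space, let $d(n)\ge 2$ be an integer, and let $\rho_n\colon M_{d(n)}\to L(L^p(X_n,\mu_n))$ be a representation. Let $A(d,\rho)\subset L\big(L^p(\prod_n X_n,\prod_n\mu_n)\big)$ be the norm closure of the linear span of all operators $\rho_1(a_1)\otimes\cdots\otimes\rho_n(a_n)\otimes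 1$ with $n\ge 0$ and $a_k\in M_{d(k)}$. (Here $b_1\otimes\cdots\otimes b_n\otimes 1$ is the unique bounded operator which sends each function $(x_k)_k\mapsto\xi_1(x_1)\cdots\xi_n(x_n)\,\eta(x_{n+1},x_{n+2},\ldots)$, with $\xi_k\in L^p(X_k,\mu_k)$ and $\eta\in L^p(\prod_{k>n}X_k,\prod_{k>n}\mu_k)$, to $(x_k)_k\mapsto(b_1\xi_1)(x_1)\cdots(b_n\xi_n)(x_n)\,\eta(x_{n+1},x_{n+2},\ldots)$.) A unital subalgebra $A\subset L(L^p(X,\mu))$, for a $\sigma$-finite measure space $(X,\mu)$, is an \emph{$L^p$ UHF algebra of tensor product type which locally has enough isometries} if it is isometrically isomorphic, as an algebra, to some $A(d,\rho)$ for which every $\rho_n$ locally has enough isometries. \textbf{Corollary.} Let $p\in[1,\infty)$ and let $A$ be an $L^p$ UHF algebra of tensor product type which locally has enough isometries. Then there exists a unique continuous linear functional $\tau\colon A\to\mathbb{C}$ such that $\tau(1)=1$ and $\tau(ba)=\tau(ab)$ for all $a,b\in A$. Moreover, $\|\tau\|=1$. -/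

import Mathlib

open MeasureTheory
open scoped ENNReal

universe u v

noncomputable section

/-- The natural representation on `ℂ^d` of a subgroup `G` of the group of invertible `d × d`
complex matrices. -/
def naturalRep {d : ℕ} (G : Subgroup (Matrix (Fin d) (Fin d) ℂ)ˣ) :
    Representation ℂ G (Fin d → ℂ) :=
  ((Matrix.toLinAlgEquiv' : Matrix (Fin d) (Fin d) ℂ ≃ₐ[ℂ] _).toAlgHom : _ →* _).comp
    ((Units.coeHom _).comp G.subtype)

/-- A unital representation `ρ` of the matrix algebra `M_d` by bounded operators on a normed space
*has enough isometries* if there is a finite group `G` of invertible matrices, acting irreducibly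
on `ℂ^d`, such that `‖ρ g‖ = 1` for all `g ∈ G`. -/
def HasEnoughIsometries {d : ℕ} {E : Type*} [NormedAddCommGroup E] [NormedSpace ℂ E]
    (ρ : Matrix (Fin d) (Fin d) ℂ →ₐ[ℂ] (E →L[ℂ] E)) : Prop :=
  ∃ G : Subgroup (Matrix (Fin d) (Fin d) ℂ)ˣ, Finite G ∧ (naturalRep G).IsIrreducible ∧
    ∀ g ∈ G, ‖ρ (g : Matrix (Fin d) (Fin d) ℂ)‖ = 1

/-- The representation `a ↦ ρ a |_V` on an invariant subspace `V`. -/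
def restrictRep {B : Type*} [Ring B] [Algebra ℂ B] {E : Type*} [NormedAddCommGroup E]
    [NormedSpace ℂ E] (ρ : B →ₐ[ℂ] (E →L[ℂ] E)) (V : Submodule ℂ E)
    (hV : ∀ a, ∀ f ∈ V, ρ a f ∈ V) : B →ₐ[ℂ] (V →L[ℂ] V) :=
  AlgHom.ofLinearMap
    { toFun := fun a => ((ρ a).comp V.subtypeL).codRestrict V fun f => hV a f f.2
      map_add' := fun a b => ContinuousLinearMap.ext fun f => Subtype.ext <| by
        change ρ (a + b) f = ρ a f + ρ b f
        simp
      map_smul' := fun c a => ContinuousLinearMap.ext fun f => Subtype.ext <| by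
        change ρ (c • a) f = c • ρ a f
        simp }
    (ContinuousLinearMap.ext fun f => Subtype.ext <| by
      change ρ 1 f = f
      simp)
    (fun a b => ContinuousLinearMap.ext fun f => Subtype.ext <| by
      change ρ (a * b) f = ρ a (ρ b f)
      simp)

/-- The subspace `L^p(s, μ)` of `L^p(X, μ)`: the functions that vanish almost everywhere
outside `s`. -/
def lpOn {X : Type*} [MeasurableSpace X] (p : ℝ≥0∞) (μ : Measure X) (s : Set X) :
    Submodule ℂ (Lp ℂ p μ) where
  carrier := {f | ∀ᵐ x ∂μ, x ∉ s → f x = 0}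
  zero_mem' := by
    change ∀ᵐ x ∂μ, x ∉ s → (0 : Lp ℂ p μ) x = 0
    filter_upwards [Lp.coeFn_zero ℂ p μ] with x hx _
    exact hx
  add_mem' := by
    intro f g (hf : ∀ᵐ x ∂μ, x ∉ s → f x = 0) (hg : ∀ᵐ x ∂μ, x ∉ s → g x = 0)
    change ∀ᵐ x ∂μ, x ∉ s → (f + g) x = 0
    filter_upwards [Lp.coeFn_add f g, hf, hg] with x hx h1 h2 hs
    rw [hx, Pi.add_apply, h1 hs, h2 hs, add_zero]
  smul_mem' := by
    intro c f (hf : ∀ᵐ x ∂μ, x ∉ s → f x = 0)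
    change ∀ᵐ x ∂μ, x ∉ s → (c • f) x = 0
    filter_upwards [Lp.coeFn_smul c f, hf] with x hx h1 hs
    rw [hx, Pi.smul_apply, h1 hs, smul_zero]

/-- A unital representation `ρ` of `M_d` on `L^p(X, μ)` *locally has enough isometries* if `X` is
the disjoint union of at most countably many measurable sets `Y i` of strictly positive measure
such that each `L^p(Y i, μ)` is `ρ`-invariant and the restriction of `ρ` to it has enough
isometries. -/
def LocallyHasEnoughIsometries {d : ℕ} {X : Type*} [MeasurableSpace X] {p : ℝ≥0∞} [Fact (1 ≤ p)]
    {μ : Measure X}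
    (ρ : Matrix (Fin d) (Fin d) ℂ →ₐ[ℂ] (Lp ℂ p μ →L[ℂ] Lp ℂ p μ)) : Prop :=
  ∃ (ι : Type) (Y : ι → Set X), Countable ι ∧ (∀ i, MeasurableSet (Y i)) ∧ (∀ i, 0 < μ (Y i)) ∧
    Pairwise (fun i j => Disjoint (Y i) (Y j)) ∧ (⋃ i, Y i) = Set.univ ∧
    ∀ i, ∃ hV : ∀ a, ∀ f ∈ lpOn p μ (Y i), ρ a f ∈ lpOn p μ (Y i),
      HasEnoughIsometries (restrictRep ρ (lpOn p μ (Y i)) hV)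

/-- The ingredients of an `L^p` UHF algebra of tensor product type: probability spaces
`(X n, μ n)`, integers `d n ≥ 2`, and unital representations `ρ n` of `M_{d n}` on
`L^p(X n, μ n)`. -/
structure UHFData (p : ℝ≥0∞) [Fact (1 ≤ p)] where
  /-- The underlying spaces. -/
  X : ℕ → Type v
  /-- Their σ-algebras. -/
  [measurableSpace : ∀ n, MeasurableSpace (X n)]
  /-- Their measures. -/
  μ : ∀ n, Measure (X n)
  [isProb : ∀ n, IsProbabilityMeasure (μ n)]
  /-- The matrix sizes. -/
  d : ℕ → ℕ
  two_le_d : ∀ n, 2 ≤ d n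
  /-- The unital representations. -/
  ρ : ∀ n, Matrix (Fin (d n)) (Fin (d n)) ℂ →ₐ[ℂ] (Lp ℂ p (μ n) →L[ℂ] Lp ℂ p (μ n))

attribute [instance] UHFData.measurableSpace UHFData.isProb

namespace UHFData

variable {p : ℝ≥0∞} [Fact (1 ≤ p)] (D : UHFData.{v} p)

/-- The product probability measure on `∏ n, X n`. -/
def prodMeasure : Measure (∀ n, D.X n) := Measure.infinitePi D.μ

/-- The product probability measure on the tail `∏ k ≥ n, X k`. -/
def tailMeasure (n : ℕ) : Measure (∀ k : {k : ℕ // n ≤ k}, D.X k) :=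
  Measure.infinitePi fun k : {k : ℕ // n ≤ k} => D.μ k

/-- The elementary tensor `ξ_0 ⊗ ⋯ ⊗ ξ_{n-1} ⊗ η`, as a function on `∏ n, X n`, for
`ξ_k ∈ L^p(X k)` and `η ∈ L^p(∏ k ≥ n, X k)`; it is well defined up to null sets. -/
def elemTensor (n : ℕ) (ξ : ∀ k : Fin n, Lp ℂ p (D.μ k)) (η : Lp ℂ p (D.tailMeasure n))
    (x : ∀ k, D.X k) : ℂ :=
  (∏ k : Fin n, ξ k (x k)) * η (fun k => x k)

/-- `c` is the operator `b_0 ⊗ ⋯ ⊗ b_{n-1} ⊗ 1` on `L^p(∏ n, X n)`, that is, the bounded operator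
with `c (ξ_0 ⊗ ⋯ ⊗ ξ_{n-1} ⊗ η) = b_0 ξ_0 ⊗ ⋯ ⊗ b_{n-1} ξ_{n-1} ⊗ η` for all `ξ_k`, `η`. -/
def IsTensorOp (n : ℕ) (b : ∀ k : Fin n, Lp ℂ p (D.μ k) →L[ℂ] Lp ℂ p (D.μ k))
    (c : Lp ℂ p D.prodMeasure →L[ℂ] Lp ℂ p D.prodMeasure) : Prop :=
  ∀ (ξ : ∀ k : Fin n, Lp ℂ p (D.μ k)) (η : Lp ℂ p (D.tailMeasure n))
    (f : Lp ℂ p D.prodMeasure), f =ᵐ[D.prodMeasure] D.elemTensor n ξ η →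
      c f =ᵐ[D.prodMeasure] D.elemTensor n (fun k => b k (ξ k)) η

/-- The `L^p` UHF algebra `A(d, ρ)`: the norm closure in the bounded operators on
`L^p(∏ n, X n)` of the unital algebra generated by (equivalently, of the linear span of) all
`ρ_0(a_0) ⊗ ⋯ ⊗ ρ_{n-1}(a_{n-1}) ⊗ 1` with `n ∈ ℕ` and `a_k ∈ M_{d k}`. -/
def algebra : Subalgebra ℂ (Lp ℂ p D.prodMeasure →L[ℂ] Lp ℂ p D.prodMeasure) :=
  (Algebra.adjoin ℂ {c | ∃ (n : ℕ) (a : ∀ k : Fin n, Matrix (Fin (D.d k)) (Fin (D.d k)) ℂ),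
    D.IsTensorOp n (fun k => D.ρ k (a k)) c}).topologicalClosure

end UHFData

/-- The unital subalgebra `A` of the bounded operators on `L^p(X, μ)` is an `L^p` UHF algebra of
tensor product type which locally has enough isometries: it is isometrically isomorphic to some
`A(d, ρ)` in which every `ρ n` locally has enough isometries. -/
def IsUHFTensorTypeLocallyEnoughIsometries {p : ℝ≥0∞} [Fact (1 ≤ p)] {X : Type u}
    [MeasurableSpace X] {μ : Measure X}
    (A : Subalgebra ℂ (Lp ℂ p μ →L[ℂ] Lp ℂ p μ)) : Prop :=
  ∃ D : UHFData.{v} p, (∃ e : A ≃ₐ[ℂ] D.algebra, ∀ a, ‖e a‖ = ‖a‖) ∧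
    ∀ n, LocallyHasEnoughIsometries (D.ρ n)

end

/-! Averaging the conjugates of a matrix over a finite irreducible group gives a matrix that
commutes with the group, hence by Schur's lemma a scalar, namely the normalised trace
(`average_conj_eq_trace`). In the product, the matrix factors act on different coordinates and
commute, so averaging over a group in one factor replaces that factor by its normalised trace and
leaves the others alone. Composing the averages over the first `n` factors therefore sends each
element of the dense subalgebra of finite tensors to a fixed scalar once `n` is large. This scalar
is the trace.

The scalar is bounded by the operator norm although the groups need not act isometrically on the
whole space. It is enough to choose in each factor one piece `Y k` of the partition. The functions
supported where the first `N` coordinates lie in the chosen pieces form a nonzero subspace,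
invariant under the first `N` factors, on which the first `N` groups act contractively. The averages
do not increase a norm bound there, and a scalar operator shows its modulus on any nonzero vector
(`norm_le_of_eventually_iterAverage_eq`). So the trace is contractive and extends to the closure.

Any continuous normalised trace is invariant under conjugation, hence under the averages, so it
takes the same scalar value on finite tensors; density gives uniqueness.

The analytic half realises each factor on the product. Viewing `L^p(Z × X)` as `L^p(Z; L^p(X))`, an
operator `b` on `L^p(X)` acts pointwise with norm at most `‖b‖`. These operators agree with the
defining tensor operators on elementary tensors, which determine them because indicators of boxes
span a dense subspace for `p < ∞`. -/

open Filter Topology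
open scoped symmDiff

/-! ### Schur averaging over a finite irreducible group -/

/-- Averaging over the conjugates by a finite irreducible matrix group gives the normalised trace. -/
theorem average_conj_eq_trace {d : ℕ} (hd : d ≠ 0) (G : Subgroup (Matrix (Fin d) (Fin d) ℂ)ˣ)
    [Fintype G] (hG : (naturalRep G).IsIrreducible) (a : Matrix (Fin d) (Fin d) ℂ) :
    (Fintype.card G : ℂ)⁻¹ • ∑ g : G, (g : (Matrix (Fin d) (Fin d) ℂ)ˣ).1 * a *
      ((g⁻¹ : G) : (Matrix (Fin d) (Fin d) ℂ)ˣ).1 = ((d : ℂ)⁻¹ * a.trace) • 1 := by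
  set B := ∑ g : G, (g : (Matrix (Fin d) (Fin d) ℂ)ˣ).1 * a *
      ((g⁻¹ : G) : (Matrix (Fin d) (Fin d) ℂ)ˣ).1 with hB
  have hcomm : ∀ h : G, (h : (Matrix (Fin d) (Fin d) ℂ)ˣ).1 * B =
      B * (h : (Matrix (Fin d) (Fin d) ℂ)ˣ).1 := by
    intro h
    rw [hB, Finset.mul_sum, Finset.sum_mul, ← Equiv.sum_comp (Equiv.mulLeft h) (fun g : G =>
      (g : (Matrix (Fin d) (Fin d) ℂ)ˣ).1 * a * ((g⁻¹ : G) : (Matrix (Fin d) (Fin d) ℂ)ˣ).1 *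
        (h : (Matrix (Fin d) (Fin d) ℂ)ˣ).1)]
    refine Finset.sum_congr rfl fun g _ => ?_
    simp [mul_assoc]
  -- Schur's lemma over `ℂ`: the intertwiner `B` is a scalar. The scalar is then read off from the
  -- trace.
  obtain ⟨c, hc⟩ := (Representation.IsIrreducible.algebraMap_intertwiningMap_bijective_of_isAlgClosed
    (k := ℂ) (ρ := naturalRep G)).2
      (LinearMap.intertwiningMap_of_isIntertwiningMap (naturalRep G) (naturalRep G)
        (Matrix.toLin' B) (fun g v => by
          change Matrix.toLin' B (Matrix.toLin' (g : (Matrix (Fin d) (Fin d) ℂ)ˣ).1 v) =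
            Matrix.toLin' (g : (Matrix (Fin d) (Fin d) ℂ)ˣ).1 (Matrix.toLin' B v)
          simp only [Matrix.toLin'_apply, Matrix.mulVec_mulVec, hcomm]))
  have hBc : B = c • 1 := by
    apply Matrix.toLin'.injective
    have := congrArg Representation.IntertwiningMap.toLinearMap hc
    refine this.symm.trans ?_
    ext; simp [Representation.IntertwiningMap.algebraMap_apply]
  have htr : B.trace = (Fintype.card G : ℂ) * a.trace := by
    rw [hB, Matrix.trace_sum]
    have : ∀ g : G, ((g : (Matrix (Fin d) (Fin d) ℂ)ˣ).1 * a *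
      ((g⁻¹ : G) : (Matrix (Fin d) (Fin d) ℂ)ˣ).1).trace = a.trace := by
      intro g
      rw [Matrix.trace_mul_comm, ← mul_assoc]
      simp
    rw [Finset.sum_congr rfl fun g _ => this g]
    simp
  have hd' : (d : ℂ) ≠ 0 := by exact_mod_cast hd
  have hcard : (Fintype.card G : ℂ) ≠ 0 := by exact_mod_cast Fintype.card_ne_zero
  rw [hBc, Matrix.trace_smul, Matrix.trace_one, Fintype.card_fin, smul_eq_mul] at htr
  rw [hBc, smul_smul]
  congr 1
  field_simp
  linear_combination htr

/-- The conditional expectation that averages over the conjugates by a finite matrix group. -/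
noncomputable def conjAverage {d : ℕ} {R : Type*} [Ring R] [Algebra ℂ R]
    (r : Matrix (Fin d) (Fin d) ℂ →ₐ[ℂ] R) (G : Subgroup (Matrix (Fin d) (Fin d) ℂ)ˣ)
    [Fintype G] : R →ₗ[ℂ] R :=
  (Fintype.card G : ℂ)⁻¹ • ∑ g : G,
    LinearMap.mulLeftRight ℂ (r (g : (Matrix (Fin d) (Fin d) ℂ)ˣ).1,
      r ((g⁻¹ : G) : (Matrix (Fin d) (Fin d) ℂ)ˣ).1)

section conjAverage

variable {d : ℕ} {R : Type*} [Ring R] [Algebra ℂ R]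
  (r : Matrix (Fin d) (Fin d) ℂ →ₐ[ℂ] R) (G : Subgroup (Matrix (Fin d) (Fin d) ℂ)ˣ) [Fintype G]

theorem conjAverage_apply (x : R) : conjAverage r G x = (Fintype.card G : ℂ)⁻¹ • ∑ g : G,
    r (g : (Matrix (Fin d) (Fin d) ℂ)ˣ).1 * x *
      r ((g⁻¹ : G) : (Matrix (Fin d) (Fin d) ℂ)ˣ).1 := by
  simp [conjAverage, LinearMap.mulLeftRight_apply]

/-- Since `y` commutes with the group, conjugation reaches only the factor `r a`, where the matrix
average applies. -/
theorem conjAverage_mul (hd : d ≠ 0) (hG : (naturalRep G).IsIrreducible)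
    (a : Matrix (Fin d) (Fin d) ℂ) {y : R} (hy : ∀ b, Commute y (r b)) :
    conjAverage r G (y * r a) = ((d : ℂ)⁻¹ * a.trace) • y := by
  have h : ∀ g : G, r (g : (Matrix (Fin d) (Fin d) ℂ)ˣ).1 * (y * r a) *
      r ((g⁻¹ : G) : (Matrix (Fin d) (Fin d) ℂ)ˣ).1 =
      y * r ((g : (Matrix (Fin d) (Fin d) ℂ)ˣ).1 * a *
        ((g⁻¹ : G) : (Matrix (Fin d) (Fin d) ℂ)ˣ).1) := by
    intro g
    rw [← mul_assoc, ← (hy _).eq, map_mul, map_mul]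
    simp only [mul_assoc]
  rw [conjAverage_apply, Finset.sum_congr rfl fun g _ => h g, ← Finset.mul_sum, ← map_sum,
    ← mul_smul_comm, ← map_smul, average_conj_eq_trace hd G hG, map_smul, map_one,
    mul_smul_comm, mul_one]

end conjAverage

/-! ### Finite tensors and iterated averages for commuting matrix algebras -/

/-- The ordered product `r 0 (a 0) * ⋯ * r (n - 1) (a (n - 1))`. -/
def monomialOp {d : ℕ → ℕ} {R : Type*} [Ring R] [Algebra ℂ R]
    (r : ∀ k, Matrix (Fin (d k)) (Fin (d k)) ℂ →ₐ[ℂ] R)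
    (a : ∀ k, Matrix (Fin (d k)) (Fin (d k)) ℂ) : ℕ → R
  | 0 => 1
  | n + 1 => monomialOp r a n * r n (a n)

/-- The composition of the averages over the first `n` matrix groups. -/
noncomputable def iterAverage {d : ℕ → ℕ} {R : Type*} [Ring R] [Algebra ℂ R]
    (r : ∀ k, Matrix (Fin (d k)) (Fin (d k)) ℂ →ₐ[ℂ] R)
    (G : ∀ k, Subgroup (Matrix (Fin (d k)) (Fin (d k)) ℂ)ˣ) [∀ k, Fintype (G k)] :
    ℕ → R →ₗ[ℂ] R
  | 0 => LinearMap.id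
  | n + 1 => iterAverage r G n ∘ₗ conjAverage (r n) (G n)

section commuting

variable {d : ℕ → ℕ} {R : Type*} [Ring R] [Algebra ℂ R]
  {r : ∀ k, Matrix (Fin (d k)) (Fin (d k)) ℂ →ₐ[ℂ] R}
  {G : ∀ k, Subgroup (Matrix (Fin (d k)) (Fin (d k)) ℂ)ˣ} [∀ k, Fintype (G k)]

theorem monomialOp_congr {a b : ∀ k, Matrix (Fin (d k)) (Fin (d k)) ℂ} {n : ℕ}
    (h : ∀ k < n, a k = b k) : monomialOp r a n = monomialOp r b n := by
  induction n with
  | zero => rfl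
  | succ n ih => rw [monomialOp, monomialOp, ih fun k hk => h k (by omega), h n (by omega)]

theorem monomialOp_eq_of_le {a : ∀ k, Matrix (Fin (d k)) (Fin (d k)) ℂ} {n m : ℕ}
    (hnm : n ≤ m) (h : ∀ k, n ≤ k → a k = 1) : monomialOp r a m = monomialOp r a n := by
  induction m, hnm using Nat.le_induction with
  | base => rfl
  | succ m hm ih => rw [monomialOp, ih, h m hm, map_one, mul_one]

/-- Every monomial of length `n` is a monomial of every larger length. -/
theorem exists_monomialOp_eq (a : ∀ k, Matrix (Fin (d k)) (Fin (d k)) ℂ) (n : ℕ) :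
    ∃ b : ∀ k, Matrix (Fin (d k)) (Fin (d k)) ℂ, (∀ k, n ≤ k → b k = 1) ∧
      ∀ m, n ≤ m → monomialOp r b m = monomialOp r a n := by
  refine ⟨fun k => if k < n then a k else 1, fun k hk => by simp [hk], fun m hm => ?_⟩
  rw [monomialOp_eq_of_le hm fun k hk => by simp [hk]]
  exact monomialOp_congr fun k hk => by simp [hk]

theorem monomialOp_mem_range (r : ∀ k, Matrix (Fin (d k)) (Fin (d k)) ℂ →ₐ[ℂ] R) (k : ℕ)
    (b : Matrix (Fin (d k)) (Fin (d k)) ℂ) : ∃ a n, monomialOp r a n = r k b := by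
  refine ⟨Function.update (fun _ => 1) k b, k + 1, ?_⟩
  rw [monomialOp, Function.update_self,
    monomialOp_congr (b := fun _ => 1) fun j hj => Function.update_of_ne hj.ne _ _,
    monomialOp_eq_of_le k.zero_le fun _ _ => rfl, monomialOp, one_mul]

variable (hr : ∀ j k, j ≠ k → ∀ a b, Commute (r j a) (r k b))
include hr

theorem commute_monomialOp (a : ∀ k, Matrix (Fin (d k)) (Fin (d k)) ℂ) {n k : ℕ} (hnk : n ≤ k)
    (b : Matrix (Fin (d k)) (Fin (d k)) ℂ) : Commute (monomialOp r a n) (r k b) := by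
  induction n with
  | zero => exact Commute.one_left _
  | succ n ih => exact (ih (by omega)).mul_left (hr n k (by omega) _ _)

theorem monomialOp_mul (a b : ∀ k, Matrix (Fin (d k)) (Fin (d k)) ℂ) (n : ℕ) :
    monomialOp r (a * b) n = monomialOp r a n * monomialOp r b n := by
  induction n with
  | zero => simp [monomialOp]
  | succ n ih =>
    rw [monomialOp, monomialOp, monomialOp, ih, Pi.mul_apply, map_mul, mul_assoc, mul_assoc,
      ← mul_assoc (monomialOp r b n), (commute_monomialOp hr b le_rfl (a n)).eq, mul_assoc]

/-- The innermost average removes the last factor, which the shorter monomial commutes with;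
induction handles the rest. -/
theorem iterAverage_monomialOp (hd : ∀ k, d k ≠ 0) (hG : ∀ k, (naturalRep (G k)).IsIrreducible)
    (a : ∀ k, Matrix (Fin (d k)) (Fin (d k)) ℂ) (n : ℕ) :
    iterAverage r G n (monomialOp r a n) =
      (∏ k ∈ Finset.range n, ((d k : ℂ)⁻¹ * (a k).trace)) • 1 := by
  induction n with
  | zero => simp [monomialOp, iterAverage]
  | succ n ih =>
    rw [monomialOp, iterAverage, LinearMap.comp_apply, conjAverage_mul (r n) (G n) (hd n) (hG n)
      (a n) fun b => commute_monomialOp hr a le_rfl b, map_smul, ih, smul_smul,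
      Finset.prod_range_succ, mul_comm]

/-- Padding with identity matrices brings two monomials to a common length, where they multiply
factorwise. They thus form a submonoid, and later statements reduce to monomials by linearity. -/
theorem adjoin_monomialOp : Subalgebra.toSubmodule (Algebra.adjoin ℂ
    {x | ∃ a n, monomialOp r a n = x}) = Submodule.span ℂ {x | ∃ a n, monomialOp r a n = x} := by
  rw [Algebra.adjoin_eq_span]
  congr 1
  let S : Submonoid R :=
    { carrier := {x | ∃ a n, monomialOp r a n = x}
      one_mem' := ⟨1, 0, rfl⟩
      mul_mem' := by
        rintro _ _ ⟨a, n, rfl⟩ ⟨b, m, rfl⟩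
        obtain ⟨a', -, ha'⟩ := exists_monomialOp_eq (r := r) a n
        obtain ⟨b', -, hb'⟩ := exists_monomialOp_eq (r := r) b m
        refine ⟨a' * b', max n m, ?_⟩
        rw [monomialOp_mul hr, ha' _ (le_max_left _ _), hb' _ (le_max_right _ _)] }
  exact congrArg SetLike.coe (Submonoid.closure_eq S)

theorem exists_eventually_iterAverage_eq (hd : ∀ k, d k ≠ 0)
    (hG : ∀ k, (naturalRep (G k)).IsIrreducible) {x : R}
    (hx : x ∈ Algebra.adjoin ℂ {x | ∃ a n, monomialOp r a n = x}) :
    ∃ t : ℂ, ∀ᶠ n in atTop, iterAverage r G n x = t • 1 := by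
  rw [← Subalgebra.mem_toSubmodule, adjoin_monomialOp hr] at hx
  induction hx using Submodule.span_induction with
  | mem x hx =>
    obtain ⟨a, n, rfl⟩ := hx
    obtain ⟨b, hb, hab⟩ := exists_monomialOp_eq (r := r) a n
    refine ⟨∏ k ∈ Finset.range n, ((d k : ℂ)⁻¹ * (b k).trace), ?_⟩
    filter_upwards [eventually_ge_atTop n] with m hm
    rw [← hab m hm, iterAverage_monomialOp hr hd hG]
    congr 1
    -- Padding matrices are `1` and have normalised trace `1`, so the product stops changing at `n`.
    refine (Finset.prod_subset (Finset.range_mono hm) fun k _ hk => ?_).symm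
    rw [hb k (by simpa using hk), Matrix.trace_one, Fintype.card_fin]
    exact inv_mul_cancel₀ (by exact_mod_cast hd k)
  | zero => exact ⟨0, by simp⟩
  | add x y _ _ hx hy =>
    obtain ⟨s, hs⟩ := hx
    obtain ⟨t, ht⟩ := hy
    refine ⟨s + t, ?_⟩
    filter_upwards [hs, ht] with n h1 h2
    rw [map_add, h1, h2, add_smul]
  | smul c x _ hx =>
    obtain ⟨s, hs⟩ := hx
    refine ⟨c * s, ?_⟩
    filter_upwards [hs] with n h1
    rw [map_smul, h1, mul_smul]

theorem eventually_iterAverage_mul_comm (hd : ∀ k, d k ≠ 0)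
    (hG : ∀ k, (naturalRep (G k)).IsIrreducible) {x y : R}
    (hx : x ∈ Algebra.adjoin ℂ {x | ∃ a n, monomialOp r a n = x})
    (hy : y ∈ Algebra.adjoin ℂ {x | ∃ a n, monomialOp r a n = x}) :
    ∀ᶠ n in atTop, iterAverage r G n (x * y) = iterAverage r G n (y * x) := by
  rw [← Subalgebra.mem_toSubmodule, adjoin_monomialOp hr] at hx hy
  induction hx, hy using Submodule.span_induction₂ with
  | mem_mem x y hx hy =>
    obtain ⟨a, n, rfl⟩ := hx
    obtain ⟨b, m, rfl⟩ := hy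
    obtain ⟨a', -, ha'⟩ := exists_monomialOp_eq (r := r) a n
    obtain ⟨b', -, hb'⟩ := exists_monomialOp_eq (r := r) b m
    filter_upwards [eventually_ge_atTop n, eventually_ge_atTop m] with k hn hm
    rw [← ha' k hn, ← hb' k hm, ← monomialOp_mul hr, ← monomialOp_mul hr,
      iterAverage_monomialOp hr hd hG, iterAverage_monomialOp hr hd hG]
    congr 1
    refine Finset.prod_congr rfl fun j _ => ?_
    rw [Pi.mul_apply, Pi.mul_apply, Matrix.trace_mul_comm]
  | zero_left => simp
  | zero_right => simp
  | add_left x y z _ _ _ h1 h2 =>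
    filter_upwards [h1, h2] with n h1 h2
    rw [add_mul, mul_add, map_add, map_add, h1, h2]
  | add_right x y z _ _ _ h1 h2 =>
    filter_upwards [h1, h2] with n h1 h2
    rw [add_mul, mul_add, map_add, map_add, h1, h2]
  | smul_left c x y _ _ h =>
    filter_upwards [h] with n h
    rw [smul_mul_assoc, mul_smul_comm, map_smul, map_smul, h]
  | smul_right c x y _ _ h =>
    filter_upwards [h] with n h
    rw [smul_mul_assoc, mul_smul_comm, map_smul, map_smul, h]

end commuting

/-! ### Contractivity on invariant subspaces and the abstract trace theorem -/

section invariant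

variable {H : Type*} [NormedAddCommGroup H] [NormedSpace ℂ H] {d : ℕ → ℕ}
  {r : ∀ k, Matrix (Fin (d k)) (Fin (d k)) ℂ →ₐ[ℂ] (H →L[ℂ] H)}
  {G : ∀ k, Subgroup (Matrix (Fin (d k)) (Fin (d k)) ℂ)ˣ} [∀ k, Fintype (G k)]

/-- Both `g` and `g⁻¹` lie in the group, so every conjugate inherits the bound `c` on `V`; the
triangle inequality passes it to the mean. Nothing is required outside `V`. -/
theorem norm_conjAverage_apply_le {V : Submodule ℂ H} {k : ℕ}
    (hr : ∀ a, ∀ v ∈ V, r k a v ∈ V)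
    (hG : ∀ g ∈ G k, ∀ v ∈ V, ‖r k (g : Matrix (Fin (d k)) (Fin (d k)) ℂ) v‖ ≤ ‖v‖)
    {x : H →L[ℂ] H} {c : ℝ} (hx : ∀ v ∈ V, x v ∈ V ∧ ‖x v‖ ≤ c * ‖v‖) (hc : 0 ≤ c) :
    ∀ v ∈ V, conjAverage (r k) (G k) x v ∈ V ∧ ‖conjAverage (r k) (G k) x v‖ ≤ c * ‖v‖ := by
  intro v hv
  have happ : conjAverage (r k) (G k) x v = (Fintype.card (G k) : ℂ)⁻¹ • ∑ g : G k,
      r k (g : (Matrix (Fin (d k)) (Fin (d k)) ℂ)ˣ).1 (x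
        (r k ((g⁻¹ : G k) : (Matrix (Fin (d k)) (Fin (d k)) ℂ)ˣ).1 v)) := by
    rw [conjAverage_apply, _root_.smul_apply, _root_.sum_apply]
    rfl
  rw [happ]
  refine ⟨V.smul_mem _ (V.sum_mem fun g _ => hr _ _ (hx _ (hr _ _ hv)).1), ?_⟩
  have hcard : (0 : ℝ) < Fintype.card (G k) := by exact_mod_cast Fintype.card_pos
  rw [norm_smul, norm_inv, Complex.norm_natCast, inv_mul_le_iff₀ hcard]
  refine (norm_sum_le _ _).trans ?_
  refine (Finset.sum_le_card_nsmul _ _ (c * ‖v‖) fun g _ => ?_).trans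
    (by rw [Finset.card_univ, nsmul_eq_mul])
  refine (hG _ g.2 _ (hx _ (hr _ _ hv)).1).trans ((hx _ (hr _ _ hv)).2.trans ?_)
  exact mul_le_mul_of_nonneg_left (hG _ (g⁻¹).2 _ hv) hc

theorem norm_iterAverage_apply_le {V : Submodule ℂ H} {n : ℕ}
    (hr : ∀ k < n, ∀ a, ∀ v ∈ V, r k a v ∈ V)
    (hG : ∀ k < n, ∀ g ∈ G k, ∀ v ∈ V, ‖r k (g : Matrix (Fin (d k)) (Fin (d k)) ℂ) v‖ ≤ ‖v‖)
    {x : H →L[ℂ] H} {c : ℝ} (hx : ∀ v ∈ V, x v ∈ V ∧ ‖x v‖ ≤ c * ‖v‖) (hc : 0 ≤ c) :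
    ∀ v ∈ V, iterAverage r G n x v ∈ V ∧ ‖iterAverage r G n x v‖ ≤ c * ‖v‖ := by
  induction n generalizing x with
  | zero => exact hx
  | succ n ih =>
    exact ih (fun k hk => hr k (by omega)) (fun k hk => hG k (by omega))
      (norm_conjAverage_apply_le (hr n (by omega)) (hG n (by omega)) hx hc)

variable {V : ℕ → Submodule ℂ H}

theorem monomialOp_apply_mem {N : ℕ} (hVr : ∀ k < N, ∀ a, ∀ v ∈ V N, r k a v ∈ V N)
    (a : ∀ k, Matrix (Fin (d k)) (Fin (d k)) ℂ) {n : ℕ} (hn : n ≤ N) :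
    ∀ v ∈ V N, monomialOp r a n v ∈ V N := by
  induction n with
  | zero => exact fun v hv => hv
  | succ n ih => exact fun v hv => ih (by omega) _ (hVr n (by omega) _ _ hv)

theorem eventually_apply_mem (hr : ∀ j k, j ≠ k → ∀ a b, Commute (r j a) (r k b))
    (hVr : ∀ N, ∀ k < N, ∀ a, ∀ v ∈ V N, r k a v ∈ V N) {x : H →L[ℂ] H}
    (hx : x ∈ Algebra.adjoin ℂ {x | ∃ a n, monomialOp r a n = x}) :
    ∀ᶠ N in atTop, ∀ v ∈ V N, x v ∈ V N := by
  rw [← Subalgebra.mem_toSubmodule, adjoin_monomialOp hr] at hx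
  induction hx using Submodule.span_induction with
  | mem x hx =>
    obtain ⟨a, n, rfl⟩ := hx
    filter_upwards [eventually_ge_atTop n] with N hN
    exact monomialOp_apply_mem (hVr N) a hN
  | zero => exact Eventually.of_forall fun N v _ => (V N).zero_mem
  | add x y _ _ hx hy =>
    filter_upwards [hx, hy] with N h1 h2 v hv
    exact (V N).add_mem (h1 v hv) (h2 v hv)
  | smul c x _ hx =>
    filter_upwards [hx] with N h1 v hv
    exact (V N).smul_mem c (h1 v hv)

/-- For large `N` the operator `x` preserves `V N` and its `N`-fold average is already `t`; testing
on one nonzero vector of `V N` compares `‖t‖` with `‖x‖`. -/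
theorem norm_le_of_eventually_iterAverage_eq
    (hr : ∀ j k, j ≠ k → ∀ a b, Commute (r j a) (r k b)) (hV : ∀ N, V N ≠ ⊥)
    (hVr : ∀ N, ∀ k < N, ∀ a, ∀ v ∈ V N, r k a v ∈ V N)
    (hVG : ∀ N, ∀ k < N, ∀ g ∈ G k, ∀ v ∈ V N,
      ‖r k (g : Matrix (Fin (d k)) (Fin (d k)) ℂ) v‖ ≤ ‖v‖) {x : H →L[ℂ] H}
    (hx : x ∈ Algebra.adjoin ℂ {x | ∃ a n, monomialOp r a n = x}) {t : ℂ}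
    (ht : ∀ᶠ n in atTop, iterAverage r G n x = t • 1) : ‖t‖ ≤ ‖x‖ := by
  obtain ⟨N, hN, hxN⟩ := (ht.and (eventually_apply_mem hr hVr hx)).exists
  obtain ⟨v, hv, hv0⟩ := (V N).exists_mem_ne_zero_of_ne_bot (hV N)
  have := (norm_iterAverage_apply_le (hVr N) (hVG N)
    (fun w hw => ⟨hxN w hw, x.le_opNorm w⟩) (norm_nonneg x) v hv).2
  rw [hN, _root_.smul_apply, norm_smul] at this
  exact le_of_mul_le_mul_right this (norm_pos_iff.2 hv0)

/-- A tracial functional is invariant under the averages. -/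
theorem trace_iterAverage {A : Subalgebra ℂ (H →L[ℂ] H)} (hA : ∀ k a, r k a ∈ A)
    {τ : A →L[ℂ] ℂ} (hτ : ∀ a b : A, τ (b * a) = τ (a * b)) (n : ℕ) (x : A) :
    ∃ hx : iterAverage r G n x ∈ A, τ ⟨_, hx⟩ = τ x := by
  induction n generalizing x with
  | zero => exact ⟨x.2, rfl⟩
  | succ n ih =>
    have key : ((((Fintype.card (G n) : ℂ)⁻¹ • ∑ g : G n,
        (⟨_, hA n (g : (Matrix (Fin (d n)) (Fin (d n)) ℂ)ˣ).1⟩ : A) * x *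
          ⟨_, hA n ((g⁻¹ : G n) : (Matrix (Fin (d n)) (Fin (d n)) ℂ)ˣ).1⟩ : A)) : H →L[ℂ] H) =
        conjAverage (r n) (G n) x := by
      rw [conjAverage_apply]
      simp
    obtain ⟨h1, h2⟩ := ih ((Fintype.card (G n) : ℂ)⁻¹ • ∑ g : G n,
        (⟨_, hA n (g : (Matrix (Fin (d n)) (Fin (d n)) ℂ)ˣ).1⟩ : A) * x *
          ⟨_, hA n ((g⁻¹ : G n) : (Matrix (Fin (d n)) (Fin (d n)) ℂ)ˣ).1⟩)
    simp only [key] at h1 h2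
    refine ⟨h1, h2.trans ?_⟩
    have hg : ∀ g : G n, τ ((⟨_, hA n (g : (Matrix (Fin (d n)) (Fin (d n)) ℂ)ˣ).1⟩ : A) * x *
          ⟨_, hA n ((g⁻¹ : G n) : (Matrix (Fin (d n)) (Fin (d n)) ℂ)ˣ).1⟩) = τ x := by
      intro g
      rw [hτ, ← mul_assoc]
      congr 1
      refine Subtype.ext ?_
      change r n _ * r n _ * (x : H →L[ℂ] H) = x
      rw [← map_mul]
      simp
    have hcard : (Fintype.card (G n) : ℂ) ≠ 0 := by exact_mod_cast Fintype.card_ne_zero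
    rw [map_smul, map_sum, Finset.sum_congr rfl fun g _ => hg g, Finset.sum_const,
      Finset.card_univ, nsmul_eq_mul, smul_eq_mul, inv_mul_cancel_left₀ hcard]

/-- Existence, uniqueness and contractivity of the normalised trace on the closed algebra generated
by commuting matrix algebras, when the group averages are contractive on nonzero invariant
subspaces. -/
theorem existsUnique_trace (hd : ∀ k, d k ≠ 0) (hG : ∀ k, (naturalRep (G k)).IsIrreducible)
    (hr : ∀ j k, j ≠ k → ∀ a b, Commute (r j a) (r k b)) (hV : ∀ N, V N ≠ ⊥)
    (hVr : ∀ N, ∀ k < N, ∀ a, ∀ v ∈ V N, r k a v ∈ V N)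
    (hVG : ∀ N, ∀ k < N, ∀ g ∈ G k, ∀ v ∈ V N,
      ‖r k (g : Matrix (Fin (d k)) (Fin (d k)) ℂ) v‖ ≤ ‖v‖)
    {A : Subalgebra ℂ (H →L[ℂ] H)}
    (hA : A = (Algebra.adjoin ℂ {x | ∃ a n, monomialOp r a n = x}).topologicalClosure) :
    ∃ τ : A →L[ℂ] ℂ, (τ 1 = 1 ∧ ∀ a b : A, τ (b * a) = τ (a * b)) ∧ (∀ a, ‖τ a‖ ≤ ‖a‖) ∧
      ∀ τ' : A →L[ℂ] ℂ, (τ' 1 = 1 ∧ ∀ a b : A, τ' (b * a) = τ' (a * b)) → τ' = τ := by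
  set B := Algebra.adjoin ℂ {x | ∃ a n, monomialOp r a n = x} with hB
  have hBA : B ≤ A := hA ▸ B.le_topologicalClosure
  have hdense : DenseRange (Subalgebra.inclusion hBA) := by
    intro x
    rw [Topology.IsEmbedding.subtypeVal.closure_eq_preimage_closure_image]
    have : (Subtype.val '' Set.range (Subalgebra.inclusion hBA) : Set (H →L[ℂ] H)) = B := by
      ext y
      constructor
      · rintro ⟨_, ⟨z, rfl⟩, rfl⟩
        exact z.2
      · exact fun hy => ⟨_, ⟨⟨y, hy⟩, rfl⟩, rfl⟩
    rw [Set.mem_preimage, this, ← Subalgebra.topologicalClosure_coe, ← hA]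
    exact x.2
  have hrA : ∀ k a, r k a ∈ A := fun k a => by
    obtain ⟨b, n, hb⟩ := monomialOp_mem_range r k a
    exact hBA (Algebra.subset_adjoin ⟨b, n, hb⟩)
  -- Nontriviality of `H` makes the limiting scalar unique, from which linearity of `t` follows.
  have hne : (1 : H →L[ℂ] H) ≠ 0 := by
    obtain ⟨v, -, hv⟩ := (V 0).exists_mem_ne_zero_of_ne_bot (hV 0)
    exact fun h => hv (congrArg (fun y : H →L[ℂ] H => y v) h)
  choose t ht using fun x : B => exists_eventually_iterAverage_eq (G := G) hr hd hG x.2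
  have huniq : ∀ (x : B) (s : ℂ), (∀ᶠ n in atTop, iterAverage r G n x = s • 1) → t x = s := by
    intro x s hs
    obtain ⟨n, h1, h2⟩ := ((ht x).and hs).exists
    exact smul_left_injective ℂ hne (h1.symm.trans h2)
  let T : B →ₗ[ℂ] ℂ :=
    { toFun := t
      map_add' := fun x y => huniq _ _ <| by
        filter_upwards [ht x, ht y] with n h1 h2
        rw [Subalgebra.coe_add, map_add, h1, h2, add_smul]
      map_smul' := fun c x => huniq _ _ <| by
        filter_upwards [ht x] with n h1
        rw [Subalgebra.coe_smul, map_smul, h1, smul_smul]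
        rfl }
  have hTnorm : ∀ x : B, ‖T x‖ ≤ 1 * ‖(Subalgebra.inclusion hBA).toLinearMap x‖ := by
    intro x
    rw [one_mul]
    exact norm_le_of_eventually_iterAverage_eq hr hV hVr hVG x.2 (ht x)
  have hext : ∀ x : B, T.extendOfNorm (Subalgebra.inclusion hBA).toLinearMap
      (Subalgebra.inclusion hBA x) = t x :=
    fun x => LinearMap.extendOfNorm_eq hdense ⟨1, hTnorm⟩ x
  refine ⟨T.extendOfNorm (Subalgebra.inclusion hBA).toLinearMap, ⟨?_, fun a b => ?_⟩,
    fun a => ?_, fun τ' hτ' => ?_⟩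
  · rw [← map_one (Subalgebra.inclusion hBA), hext]
    refine huniq _ _ (Eventually.of_forall fun n => ?_)
    have : (1 : H →L[ℂ] H) = monomialOp r 1 n :=
      (monomialOp_eq_of_le (n := 0) n.zero_le fun _ _ => rfl).symm
    rw [Subalgebra.coe_one, this, iterAverage_monomialOp hr hd hG, ← this]
    congr 1
    refine Finset.prod_eq_one fun k _ => ?_
    rw [Pi.one_apply, Matrix.trace_one, Fintype.card_fin]
    exact inv_mul_cancel₀ (by exact_mod_cast hd k)
  · refine hdense.induction_on₂ (p := fun a b => T.extendOfNorm
      (Subalgebra.inclusion hBA).toLinearMap (b * a) = T.extendOfNorm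
      (Subalgebra.inclusion hBA).toLinearMap (a * b)) (isClosed_eq (by fun_prop) (by fun_prop))
      (fun x y => ?_) a b
    rw [← map_mul, ← map_mul, hext, hext]
    refine huniq _ _ ?_
    filter_upwards [eventually_iterAverage_mul_comm (G := G) hr hd hG x.2 y.2, ht (x * y)]
      with n h1 h2
    rw [← h2]
    exact h1.symm
  · exact (LinearMap.norm_extendOfNorm_apply_le hdense 1 hTnorm a).trans_eq (one_mul _)
  · refine ContinuousLinearMap.coeFn_injective
      (hdense.equalizer τ'.continuous (ContinuousLinearMap.continuous _) (funext fun x => ?_))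
    rw [Function.comp_apply, Function.comp_apply, hext]
    obtain ⟨n, hn⟩ := (ht x).exists
    obtain ⟨h1, h2⟩ := trace_iterAverage (G := G) hrA hτ'.2 n (Subalgebra.inclusion hBA x)
    rw [← h2]
    -- Invariance has replaced `x` by its average, a scalar, on which normalisation fixes the value.
    have : (⟨_, h1⟩ : A) = t x • 1 := Subtype.ext hn
    rw [this, map_smul, hτ'.1, smul_eq_mul, mul_one]

end invariant

/-! ### Density of indicators of a generating `π`-system -/

/-- A closed subspace of `L^p` containing the indicators of a generating `π`-system is everything. -/
theorem Lp.eq_top_of_indicatorConstLp_mem {Ω : Type*} [m : MeasurableSpace Ω] {P : Measure Ω}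
    [IsFiniteMeasure P] {p : ℝ≥0∞} [Fact (1 ≤ p)] (hp : p ≠ ∞) {C : Set (Set Ω)}
    (hgen : m = MeasurableSpace.generateFrom C) (hpi : IsPiSystem C) (huniv : Set.univ ∈ C)
    {W : Submodule ℂ (Lp ℂ p P)} (hW : IsClosed (W : Set (Lp ℂ p P)))
    (h : ∀ s (hs : MeasurableSet s), s ∈ C →
      indicatorConstLp p hs (measure_ne_top P s) (1 : ℂ) ∈ W) : W = ⊤ := by
  have key : ∀ s (hs : MeasurableSet s), indicatorConstLp p hs (measure_ne_top P s) (1 : ℂ) ∈ W := by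
    intro s hs
    induction s, hs using MeasurableSpace.induction_on_inter hgen hpi with
    | empty => simp
    | basic t ht => exact h t _ ht
    | compl t ht ih =>
      have h1 : indicatorConstLp p ht.compl (measure_ne_top P _) (1 : ℂ) =
          indicatorConstLp p MeasurableSet.univ (measure_ne_top P _) (1 : ℂ) -
            indicatorConstLp p ht (measure_ne_top P _) (1 : ℂ) := by
        rw [eq_sub_iff_add_eq, ← indicatorConstLp_disjoint_union _ _ _ _ disjoint_compl_left]
        congr 1
        exact Set.compl_union_self t
      rw [h1]
      exact W.sub_mem (h _ _ huniv) ih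
    | iUnion f hf hm ih =>
      -- Finite disjoint unions stay in `W` by addition; they converge to the full union in `L^p`
      -- because the missing measure tends to zero.
      have hpart : ∀ n : ℕ, ∃ hn : MeasurableSet (⋃ i ∈ Finset.range n, f i),
          indicatorConstLp p hn (measure_ne_top P _) (1 : ℂ) ∈ W := by
        intro n
        induction n with
        | zero => simp
        | succ n ihn =>
          obtain ⟨hn, hmem⟩ := ihn
          have hd : Disjoint (f n) (⋃ i ∈ Finset.range n, f i) :=
            Set.disjoint_iUnion₂_right.2 fun i hi => hf (Finset.mem_range.1 hi).ne'
          have := W.add_mem (ih n) hmem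
          rw [← indicatorConstLp_disjoint_union _ _ _ _ hd] at this
          have heq : ⋃ i ∈ Finset.range (n + 1), f i = f n ∪ ⋃ i ∈ Finset.range n, f i := by
            rw [Finset.range_add_one, Finset.set_biUnion_insert]
          simp only [heq]
          exact ⟨(hm n).union hn, this⟩
      choose hn hpart using hpart
      refine hW.mem_of_tendsto (b := atTop) (tendsto_indicatorConstLp_set hp ?_) (Eventually.of_forall hpart)
      have hmono : Monotone fun n => ⋃ i ∈ Finset.range n, f i := fun n m hnm =>
        Set.biUnion_subset_biUnion_left (Finset.range_mono hnm)
      have hU : ⋃ n, ⋃ i ∈ Finset.range n, f i = ⋃ i, f i := by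
        ext x
        simp only [Set.mem_iUnion, Finset.mem_range, exists_prop]
        exact ⟨fun ⟨_, i, _, h⟩ => ⟨i, h⟩, fun ⟨i, h⟩ => ⟨i + 1, i, by omega, h⟩⟩
      have hlim := tendsto_measure_iUnion_atTop (μ := P) hmono
      rw [hU] at hlim
      have hsub : ∀ n, ⋃ i ∈ Finset.range n, f i ⊆ ⋃ i, f i := fun n =>
        Set.iUnion₂_subset fun i _ => Set.subset_iUnion f i
      have hdiff : ∀ n, P ((⋃ i ∈ Finset.range n, f i) ∆ (⋃ i, f i)) =
          P (⋃ i, f i) - P (⋃ i ∈ Finset.range n, f i) := fun n => by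
        rw [Set.symmDiff_def, Set.sdiff_eq_empty.2 (hsub n), Set.empty_union,
          measure_sdiff (hsub n) (hn n).nullMeasurableSet (measure_ne_top P _)]
      simp only [hdiff]
      simpa using ENNReal.Tendsto.sub (tendsto_const_nhds (x := P (⋃ i, f i))) hlim
        (Or.inl (measure_ne_top P _))
  refine eq_top_iff.2 fun f _ => ?_
  refine Lp.induction hp (fun f => f ∈ W) (fun c s hs hsP => ?_) (fun f g hf hg _ h1 h2 => ?_) hW f
  · rw [Lp.simpleFunc.coe_indicatorConst]
    have : indicatorConstLp p hs hsP.ne c = c • indicatorConstLp p hs hsP.ne (1 : ℂ) := by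
      rw [indicatorConstLp, indicatorConstLp, ← MemLp.toLp_const_smul]
      refine MemLp.toLp_congr _ _ (Eventually.of_forall fun x => ?_)
      rw [Pi.smul_apply, ← Set.indicator_const_smul_apply, smul_eq_mul, mul_one]
    rw [this]
    exact W.smul_mem c (key s hs)
  · exact W.add_mem h1 h2

/-! ### Amplification of operators to a product space -/

section amplification

variable {X Z Ω : Type*} [MeasurableSpace X] [MeasurableSpace Z] [MeasurableSpace Ω]
  {μ : Measure X} {ν : Measure Z} {P : Measure Ω} {p : ℝ≥0∞}

/-- A simple function involves only finitely many classes, so their chosen representatives glue to a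
jointly measurable function. -/
theorem measurable_simpleFunc_apply (s : SimpleFunc Z (Lp ℂ p μ)) :
    Measurable fun q : Z × X => s q.1 q.2 :=
  (s.comp Prod.fst measurable_fst).measurable_bind (fun ξ q => ξ q.2) fun ξ =>
    (Lp.stronglyMeasurable ξ).measurable.comp measurable_snd

/-- Tonelli: the inner integral over `X` is the `p`-th power of the norm of `s z`. This is the
isometry behind `L^p(Z × X) = L^p(Z; L^p(X))`. -/
theorem eLpNorm_simpleFunc_apply [SFinite μ] [Fact (1 ≤ p)] (hp : p ≠ ∞) (s : SimpleFunc Z (Lp ℂ p μ)) :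
    eLpNorm (fun q : Z × X => s q.1 q.2) p (ν.prod μ) = eLpNorm s p ν := by
  have hp0 : p ≠ 0 := (zero_lt_one.trans_le Fact.out).ne'
  have hpr : 0 < p.toReal := ENNReal.toReal_pos hp0 hp
  rw [eLpNorm_eq_lintegral_rpow_enorm_toReal hp0 hp, eLpNorm_eq_lintegral_rpow_enorm_toReal hp0 hp]
  congr 1
  rw [lintegral_prod _ ((measurable_simpleFunc_apply s).enorm.pow_const _).aemeasurable]
  refine lintegral_congr fun z => ?_
  rw [Lp.enorm_def, eLpNorm_eq_lintegral_rpow_enorm_toReal hp0 hp, ← ENNReal.rpow_mul,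
    one_div_mul_cancel hpr.ne', ENNReal.rpow_one]

theorem ae_prod_of_forall_ae [SFinite μ] {q : Z × X → Prop} (hq : MeasurableSet {x | q x})
    (h : ∀ z, ∀ᵐ x ∂μ, q (z, x)) : ∀ᵐ x ∂(ν.prod μ), q x :=
  (Measure.ae_prod_iff_ae_ae hq).2 (Eventually.of_forall h)

variable [SFinite μ] [IsFiniteMeasure ν] [Fact (1 ≤ p)]

theorem memLp_simpleFunc_comp (hp : p ≠ ∞) {φ : Ω → Z × X}
    (hφ : MeasurePreserving φ P (ν.prod μ)) (s : SimpleFunc Z (Lp ℂ p μ)) :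
    MemLp (fun ω => s (φ ω).1 (φ ω).2) p P :=
  MemLp.comp_measurePreserving (g := fun q : Z × X => s q.1 q.2)
    ⟨(measurable_simpleFunc_apply s).aestronglyMeasurable, by
      rw [eLpNorm_simpleFunc_apply hp]
      exact (s.memLp_of_isFiniteMeasure p ν).2⟩ hφ

/-- The function `ω ↦ s (φ ω).1 (φ ω).2` in `L^p`, for a simple function `s` with values in
`L^p`. -/
noncomputable def simpleFuncToLp (hp : p ≠ ∞) {φ : Ω → Z × X} (hφ : MeasurePreserving φ P (ν.prod μ)) :
    SimpleFunc Z (Lp ℂ p μ) →ₗ[ℂ] Lp ℂ p P where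
  toFun s := (memLp_simpleFunc_comp hp hφ s).toLp _
  map_add' s t := by
    refine Eq.trans (MemLp.toLp_congr _
      ((memLp_simpleFunc_comp hp hφ s).add (memLp_simpleFunc_comp hp hφ t))
      (hφ.quasiMeasurePreserving.ae (p := fun q : Z × X =>
      (s + t) q.1 q.2 = s q.1 q.2 + t q.1 q.2) (ae_prod_of_forall_ae ?_ fun z => ?_)))
      (MemLp.toLp_add _ _)
    · exact measurableSet_eq_fun (measurable_simpleFunc_apply _)
        ((measurable_simpleFunc_apply _).add (measurable_simpleFunc_apply _))
    · exact Lp.coeFn_add (s z) (t z)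
  map_smul' c s := by
    refine Eq.trans (MemLp.toLp_congr _ ((memLp_simpleFunc_comp hp hφ s).const_smul c)
      (hφ.quasiMeasurePreserving.ae (p := fun q : Z × X =>
      (c • s) q.1 q.2 = c • s q.1 q.2) (ae_prod_of_forall_ae ?_ fun z => ?_)))
      (MemLp.toLp_const_smul c _)
    · exact measurableSet_eq_fun (measurable_simpleFunc_apply _)
        ((measurable_simpleFunc_apply _).const_smul c)
    · exact Lp.coeFn_smul c (s z)

theorem coeFn_simpleFuncToLp (hp : p ≠ ∞) {φ : Ω → Z × X} (hφ : MeasurePreserving φ P (ν.prod μ))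
    (s : SimpleFunc Z (Lp ℂ p μ)) :
    simpleFuncToLp hp hφ s =ᵐ[P] fun ω => s (φ ω).1 (φ ω).2 :=
  (memLp_simpleFunc_comp hp hφ s).coeFn_toLp

theorem norm_simpleFuncToLp (hp : p ≠ ∞) {φ : Ω → Z × X} (hφ : MeasurePreserving φ P (ν.prod μ))
    (s : SimpleFunc Z (Lp ℂ p μ)) :
    ‖simpleFuncToLp hp hφ s‖ = (eLpNorm s p ν).toReal := by
  rw [simpleFuncToLp, LinearMap.coe_mk, AddHom.coe_mk, Lp.norm_toLp, ← eLpNorm_simpleFunc_apply hp,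
    ← eLpNorm_comp_measurePreserving (measurable_simpleFunc_apply s).aestronglyMeasurable hφ]
  rfl

/-- Postcomposition of `L^p`-valued simple functions with a bounded operator. -/
noncomputable def simpleFuncMap (b : Lp ℂ p μ →L[ℂ] Lp ℂ p μ) :
    SimpleFunc Z (Lp ℂ p μ) →ₗ[ℂ] SimpleFunc Z (Lp ℂ p μ) where
  toFun s := s.map b
  map_add' _ _ := SimpleFunc.ext fun _ => map_add b _ _
  map_smul' _ _ := SimpleFunc.ext fun _ => map_smul b _ _

/-- The bound `‖b (s z)‖ ≤ ‖b‖ * ‖s z‖` holds for each `z`, so the vector-valued norm inherits it.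
-/
theorem norm_simpleFuncToLp_map_le (hp : p ≠ ∞) {φ : Ω → Z × X}
    (hφ : MeasurePreserving φ P (ν.prod μ)) (b : Lp ℂ p μ →L[ℂ] Lp ℂ p μ)
    (s : SimpleFunc Z (Lp ℂ p μ)) :
    ‖(simpleFuncToLp hp hφ ∘ₗ simpleFuncMap b) s‖ ≤ ‖b‖ * ‖simpleFuncToLp hp hφ s‖ := by
  rw [LinearMap.comp_apply, norm_simpleFuncToLp, norm_simpleFuncToLp, ← coe_nnnorm,
    ← ENNReal.coe_toReal, ← ENNReal.toReal_mul]
  refine ENNReal.toReal_mono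
    (ENNReal.mul_ne_top ENNReal.coe_ne_top (s.memLp_of_isFiniteMeasure p ν).2.ne) ?_
  exact eLpNorm_le_nnreal_smul_eLpNorm_of_ae_le_mul
    (Eventually.of_forall fun z => b.le_opNNNorm (s z)) p

/-- The amplification `b ↦ 1 ⊗ b` of operators on `L^p(X)` to operators on `L^p(Ω)`, where
`Ω` is a copy of `Z × X`. -/
noncomputable def amplify (hp : p ≠ ∞) {φ : Ω → Z × X} (hφ : MeasurePreserving φ P (ν.prod μ))
    (hd : DenseRange (simpleFuncToLp hp hφ)) :
    (Lp ℂ p μ →L[ℂ] Lp ℂ p μ) →ₐ[ℂ] (Lp ℂ p P →L[ℂ] Lp ℂ p P) :=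
  have happ : ∀ b s, (simpleFuncToLp hp hφ ∘ₗ simpleFuncMap b).extendOfNorm (simpleFuncToLp hp hφ)
      (simpleFuncToLp hp hφ s) = simpleFuncToLp hp hφ (simpleFuncMap b s) := fun b s =>
    LinearMap.extendOfNorm_eq hd ⟨‖b‖, norm_simpleFuncToLp_map_le hp hφ b⟩ s
  have hext : ∀ b, ∀ c : Lp ℂ p P →L[ℂ] Lp ℂ p P, (∀ s, c (simpleFuncToLp hp hφ s) =
      simpleFuncToLp hp hφ (simpleFuncMap b s)) →
      (simpleFuncToLp hp hφ ∘ₗ simpleFuncMap b).extendOfNorm (simpleFuncToLp hp hφ) = c :=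
    fun b c hc => ContinuousLinearMap.coeFn_injective <|
      hd.equalizer (ContinuousLinearMap.continuous _) c.continuous <| funext fun s => by
        rw [Function.comp_apply, Function.comp_apply, happ, hc]
  AlgHom.ofLinearMap
    { toFun := fun b => (simpleFuncToLp hp hφ ∘ₗ simpleFuncMap b).extendOfNorm
        (simpleFuncToLp hp hφ)
      map_add' := fun b c => hext _ _ fun s => by
        rw [_root_.add_apply, happ, happ, ← map_add]
        rfl
      map_smul' := fun a b => hext _ _ fun s => by
        rw [_root_.smul_apply, happ, ← map_smul]
        rfl }
    (hext _ _ fun s => rfl)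
    (fun b c => hext _ _ fun s => by
      change LinearMap.extendOfNorm _ _ (LinearMap.extendOfNorm _ _ _) = _
      rw [happ, happ]
      rfl)

variable (hp : p ≠ ∞) {φ : Ω → Z × X} (hφ : MeasurePreserving φ P (ν.prod μ))
    (hd : DenseRange (simpleFuncToLp hp hφ))

theorem amplify_simpleFuncToLp (b : Lp ℂ p μ →L[ℂ] Lp ℂ p μ) (s : SimpleFunc Z (Lp ℂ p μ)) :
    amplify hp hφ hd b (simpleFuncToLp hp hφ s) = simpleFuncToLp hp hφ (s.map b) :=
  LinearMap.extendOfNorm_eq hd ⟨‖b‖, norm_simpleFuncToLp_map_le hp hφ b⟩ s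

theorem norm_amplify_apply_le (b : Lp ℂ p μ →L[ℂ] Lp ℂ p μ) (f : Lp ℂ p P) :
    ‖amplify hp hφ hd b f‖ ≤ ‖b‖ * ‖f‖ :=
  LinearMap.norm_extendOfNorm_apply_le hd ‖b‖ (norm_simpleFuncToLp_map_le hp hφ b) f

end amplification

section amplification

variable {X Z Ω : Type*} [MeasurableSpace X] [MeasurableSpace Z] [MeasurableSpace Ω]
  {μ : Measure X} {ν : Measure Z} {P : Measure Ω} [SFinite μ] [IsFiniteMeasure ν]
  {p : ℝ≥0∞} [Fact (1 ≤ p)] (hp : p ≠ ∞) {φ : Ω → Z × X} (hφ : MeasurePreserving φ P (ν.prod μ))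

include hp hφ in
omit [IsFiniteMeasure ν] in
theorem eLpNorm_mul_comp {ξ : X → ℂ} (hξ : Measurable ξ) {h : Z → ℂ} (hh : Measurable h) :
    eLpNorm (fun ω => ξ (φ ω).2 * h (φ ω).1) p P = eLpNorm h p ν * eLpNorm ξ p μ := by
  have hp0 : p ≠ 0 := (zero_lt_one.trans_le Fact.out).ne'
  have hpr : 0 < p.toReal := ENNReal.toReal_pos hp0 hp
  have hm : Measurable fun q : Z × X => ξ q.2 * h q.1 :=
    (hξ.comp measurable_snd).mul (hh.comp measurable_fst)
  have hcomp := eLpNorm_comp_measurePreserving (p := p) hm.aestronglyMeasurable hφ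
  rw [Function.comp_def] at hcomp
  rw [hcomp, eLpNorm_eq_lintegral_rpow_enorm_toReal hp0 hp,
    eLpNorm_eq_lintegral_rpow_enorm_toReal hp0 hp, eLpNorm_eq_lintegral_rpow_enorm_toReal hp0 hp,
    ← ENNReal.mul_rpow_of_nonneg _ _ (by positivity), ← lintegral_prod_mul
      (hh.enorm.pow_const _).aemeasurable (hξ.enorm.pow_const _).aemeasurable]
  congr 1
  refine lintegral_congr fun q => ?_
  rw [enorm_mul, ENNReal.mul_rpow_of_nonneg _ _ hpr.le, mul_comm]

/-- The simple function `z ↦ g z • ξ` with values in `L^p`. -/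
noncomputable def simpleFuncSmul (g : SimpleFunc Z ℂ) (ξ : Lp ℂ p μ) : SimpleFunc Z (Lp ℂ p μ) :=
  g.map fun c => c • ξ

theorem coeFn_simpleFuncToLp_smul (g : SimpleFunc Z ℂ) (ξ : Lp ℂ p μ) :
    simpleFuncToLp hp hφ (simpleFuncSmul g ξ) =ᵐ[P] fun ω => ξ (φ ω).2 * g (φ ω).1 := by
  refine (coeFn_simpleFuncToLp hp hφ _).trans (hφ.quasiMeasurePreserving.ae (p := fun q : Z × X =>
      simpleFuncSmul g ξ q.1 q.2 = ξ q.2 * g q.1) (ae_prod_of_forall_ae ?_ fun z => ?_))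
  · exact measurableSet_eq_fun (measurable_simpleFunc_apply _)
      (((Lp.stronglyMeasurable ξ).measurable.comp measurable_snd).mul
        (g.measurable.comp measurable_fst))
  · filter_upwards [Lp.coeFn_smul (g z) ξ] with x hx
    rw [mul_comm]
    exact hx

theorem norm_sub_simpleFuncToLp_smul {ξ : Lp ℂ p μ} {h : Z → ℂ} (hh : Measurable h) {f : Lp ℂ p P}
    (hf : f =ᵐ[P] fun ω => ξ (φ ω).2 * h (φ ω).1) (g : SimpleFunc Z ℂ) :
    ‖f - simpleFuncToLp hp hφ (simpleFuncSmul g ξ)‖ = (eLpNorm (h - ⇑g) p ν).toReal * ‖ξ‖ := by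
  rw [Lp.norm_def, Lp.norm_def, ← ENNReal.toReal_mul, ← eLpNorm_mul_comp hp hφ
    (Lp.stronglyMeasurable ξ).measurable (hh.sub g.measurable)]
  congr 1
  refine eLpNorm_congr_ae ?_
  filter_upwards [Lp.coeFn_sub f (simpleFuncToLp hp hφ (simpleFuncSmul g ξ)), hf,
    coeFn_simpleFuncToLp_smul hp hφ g ξ] with ω h1 h2 h3
  rw [h1, Pi.sub_apply, h2, h3, Pi.sub_apply, mul_sub]

/-- The amplification acts on the last factor of elementary tensors. -/
theorem coeFn_amplify (hd : DenseRange (simpleFuncToLp hp hφ)) (b : Lp ℂ p μ →L[ℂ] Lp ℂ p μ)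
    {ξ : Lp ℂ p μ} {h : Z → ℂ} (hh : Measurable h) {f : Lp ℂ p P}
    (hf : f =ᵐ[P] fun ω => ξ (φ ω).2 * h (φ ω).1) :
    amplify hp hφ hd b f =ᵐ[P] fun ω => b ξ (φ ω).2 * h (φ ω).1 := by
  have hξm : ∀ ξ : Lp ℂ p μ, Measurable ξ := fun ξ => (Lp.stronglyMeasurable ξ).measurable
  -- If `ξ = 0`, the tensor vanishes whatever `h` is, and `h` need not lie in `L^p`. Otherwise
  -- finiteness of the product norm forces `h` into `L^p`.
  by_cases hξ : ξ = 0
  · subst hξ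
    have h0 : ∀ᵐ ω ∂P, (0 : Lp ℂ p μ) (φ ω).2 = 0 :=
      (Measure.quasiMeasurePreserving_snd.comp hφ.quasiMeasurePreserving).ae (Lp.coeFn_zero ℂ p μ)
    have hf0 : f = 0 := by
      refine Lp.ext ?_
      filter_upwards [hf, h0, Lp.coeFn_zero ℂ p P] with ω h1 h2 h3
      rw [h1, h2, h3, zero_mul, Pi.zero_apply]
    rw [hf0, map_zero, map_zero]
    filter_upwards [h0, Lp.coeFn_zero ℂ p P] with ω h2 h3
    rw [h2, h3, zero_mul, Pi.zero_apply]
  have hhp : MemLp h p ν := by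
    refine ⟨hh.aestronglyMeasurable, lt_top_iff_ne_top.2 fun htop => ?_⟩
    have h1 := eLpNorm_mul_comp hp hφ (hξm ξ) hh
    rw [← eLpNorm_congr_ae hf, htop, ENNReal.top_mul] at h1
    · exact Lp.eLpNorm_ne_top f h1
    · intro h2
      exact hξ ((Lp.norm_eq_zero_iff (zero_lt_one.trans_le Fact.out)).1
        (by rw [Lp.norm_def, h2, ENNReal.toReal_zero]))
  have hmem : MemLp (fun ω => b ξ (φ ω).2 * h (φ ω).1) p P := by
    have hm : Measurable fun ω => b ξ (φ ω).2 * h (φ ω).1 :=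
      ((hξm (b ξ)).comp (measurable_snd.comp hφ.measurable)).mul
        (hh.comp (measurable_fst.comp hφ.measurable))
    refine ⟨hm.aestronglyMeasurable, ?_⟩
    rw [eLpNorm_mul_comp hp hφ (hξm (b ξ)) hh]
    exact ENNReal.mul_lt_top hhp.2 (Lp.memLp _).2
  suffices amplify hp hφ hd b f = hmem.toLp _ by
    rw [this]
    exact hmem.coeFn_toLp
  rw [← sub_eq_zero, ← norm_le_zero_iff]
  refine le_of_forall_pos_le_add fun ε hε => ?_
  -- The two approximation errors scale with `‖b‖ * ‖ξ‖` and `‖b ξ‖`; the added `1` keeps `C`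
  -- positive.
  set C : ℝ := ‖b‖ * ‖ξ‖ + ‖b ξ‖ + 1 with hC
  have hCpos : 0 < C := by positivity
  obtain ⟨g, hg, -⟩ := hhp.exists_simpleFunc_eLpNorm_sub_lt hp
    (ε := ENNReal.ofReal (ε / C)) (by simpa using div_pos hε hCpos)
  have hg' : (eLpNorm (h - ⇑g) p ν).toReal ≤ ε / C :=
    ENNReal.toReal_le_of_le_ofReal (by positivity) hg.le
  have hmap : (simpleFuncSmul g ξ).map b = simpleFuncSmul g (b ξ) :=
    SimpleFunc.ext fun z => map_smul b _ _
  have h1 := norm_sub_simpleFuncToLp_smul hp hφ hh hf g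
  have h2 := norm_sub_simpleFuncToLp_smul hp hφ hh hmem.coeFn_toLp g
  have h3 := norm_amplify_apply_le hp hφ hd b (f - simpleFuncToLp hp hφ (simpleFuncSmul g ξ))
  rw [map_sub, amplify_simpleFuncToLp, hmap, h1] at h3
  calc ‖amplify hp hφ hd b f - hmem.toLp _‖
      ≤ ‖amplify hp hφ hd b f - simpleFuncToLp hp hφ (simpleFuncSmul g (b ξ))‖ +
        ‖hmem.toLp _ - simpleFuncToLp hp hφ (simpleFuncSmul g (b ξ))‖ := by
        rw [norm_sub_rev (hmem.toLp _)]
        exact norm_sub_le_norm_sub_add_norm_sub _ _ _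
    _ ≤ (eLpNorm (h - ⇑g) p ν).toReal * C := by
        rw [h2, hC]
        nlinarith [ENNReal.toReal_nonneg (a := eLpNorm (h - ⇑g) p ν)]
    _ ≤ ε / C * C := by gcongr
    _ = 0 + ε := by rw [div_mul_cancel₀ _ hCpos.ne', zero_add]

end amplification

/-! ### Splitting one coordinate off an infinite product -/

section infinitePi

variable {ι : Type*} {X : ι → Type*} [∀ i, MeasurableSpace (X i)] (μ : ∀ i, Measure (X i))
  [∀ i, IsProbabilityMeasure (μ i)]

/-- Splitting off the coordinate `k` of a product space. -/
def splitCoord (X : ι → Type*) (k : ι) (x : ∀ i, X i) : (∀ j : {j // j ≠ k}, X j) × X k :=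
  (fun j => x j, x k)

theorem measurable_splitCoord (k : ι) : Measurable (splitCoord X k) := by
  unfold splitCoord
  fun_prop

theorem univ_mem_squareCylinders :
    Set.univ ∈ squareCylinders fun i => {s : Set (X i) | MeasurableSet s} :=
  ⟨∅, fun _ => Set.univ, fun _ _ => MeasurableSet.univ, by simp⟩

theorem isPiSystem_squareCylinders_measurableSet :
    IsPiSystem (squareCylinders fun i => {s : Set (X i) | MeasurableSet s}) :=
  isPiSystem_squareCylinders (fun _ => MeasurableSpace.isPiSystem_measurableSet)
    fun _ => MeasurableSet.univ

/-- Product measures are determined on rectangles of a cylinder and a measurable set, whose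
preimages are again cylinders. -/
theorem measurePreserving_splitCoord (k : ι) : MeasurePreserving (splitCoord X k)
    (Measure.infinitePi μ) ((Measure.infinitePi fun j : {j // j ≠ k} => μ j).prod (μ k)) := by
  classical
  refine ⟨measurable_splitCoord k, (Measure.prod_eq_generateFrom generateFrom_squareCylinders
    MeasurableSpace.generateFrom_measurableSet isPiSystem_squareCylinders_measurableSet
    MeasurableSpace.isPiSystem_measurableSet
    ⟨fun _ => Set.univ, fun _ => univ_mem_squareCylinders, fun _ => measure_lt_top _ _,
      Set.iUnion_const _⟩
    ⟨fun _ => Set.univ, fun _ => MeasurableSet.univ, fun _ => measure_lt_top _ _,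
      Set.iUnion_const _⟩ ?_).symm⟩
  rintro _ ⟨s, t, ht, rfl⟩ A (hA : MeasurableSet A)
  have ht' : ∀ j, MeasurableSet (t j) := fun j => ht j trivial
  set T : ∀ i, Set (X i) :=
    Function.update (fun i => if h : i ≠ k then t ⟨i, h⟩ else Set.univ) k A with hT
  have hTk : T k = A := Function.update_self _ _ _
  have hTj : ∀ j : {j // j ≠ k}, T j = t j := fun j => by
    rw [hT, Function.update_of_ne j.2, dif_pos j.2]
  have hTm : ∀ i, MeasurableSet (T i) := fun i => by
    by_cases h : i = k
    · subst h
      rwa [hTk]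
    · exact hTj ⟨i, h⟩ ▸ ht' _
  have hpre : splitCoord X k ⁻¹' ((s : Set _).pi t ×ˢ A) =
      ((insert k (s.map (Function.Embedding.subtype _)) : Finset ι) : Set ι).pi T := by
    ext x
    simp only [Set.mem_preimage, Set.mem_prod, Set.mem_pi, SetLike.mem_coe, Finset.forall_mem_insert,
      Finset.forall_mem_map, hTk]
    rw [and_comm]
    refine and_congr Iff.rfl (forall₂_congr fun j _ => ?_)
    change _ ↔ x j ∈ T j
    rw [hTj]
    rfl
  rw [Measure.map_apply (measurable_splitCoord k)
    ((MeasurableSet.pi s.countable_toSet fun j _ => ht' j).prod hA), hpre,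
    Measure.infinitePi_pi μ fun i _ => hTm i, Finset.prod_insert (by simp), hTk, Finset.prod_map,
    Measure.infinitePi_pi _ fun j _ => ht' j, mul_comm]
  congr 1
  exact Finset.prod_congr rfl fun j _ => congrArg _ (hTj j)

variable {μ}

/-- The indicator of a box factors into one in coordinate `k` and one in the remaining coordinates,
hence lies in the range. -/
theorem denseRange_simpleFuncToLp_splitCoord {p : ℝ≥0∞} [Fact (1 ≤ p)] (hp : p ≠ ∞) (k : ι) :
    DenseRange (simpleFuncToLp hp (measurePreserving_splitCoord μ k)) := by
  classical
  have htop : (LinearMap.range (simpleFuncToLp hp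
      (measurePreserving_splitCoord μ k))).topologicalClosure = ⊤ := by
    refine Lp.eq_top_of_indicatorConstLp_mem hp generateFrom_squareCylinders.symm
      isPiSystem_squareCylinders_measurableSet univ_mem_squareCylinders
      (Submodule.isClosed_topologicalClosure _) ?_
    rintro _ hS ⟨s, t, ht, rfl⟩
    have ht' : ∀ j, MeasurableSet (t j) := fun j => ht j trivial
    refine Submodule.le_topologicalClosure _ ?_
    set B : Set (∀ j : {j // j ≠ k}, X j) :=
      ((s.subtype (· ≠ k) : Finset _) : Set _).pi fun j => t j with hB
    have hBm : MeasurableSet B := MeasurableSet.pi (Finset.countable_toSet _) fun j _ => ht' j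
    -- The implication gives the whole space when coordinate `k` is unconstrained.
    set A : Set (X k) := {y | k ∈ s → y ∈ t k} with hA
    have hAm : MeasurableSet A := by
      by_cases h : k ∈ s
      · simpa [hA, h] using ht' k
      · simp [hA, h]
    refine ⟨simpleFuncSmul (SimpleFunc.piecewise B hBm (SimpleFunc.const _ 1)
      (SimpleFunc.const _ 0)) (indicatorConstLp p hAm (measure_ne_top _ _) 1), Lp.ext ?_⟩
    filter_upwards [coeFn_simpleFuncToLp_smul hp (measurePreserving_splitCoord μ k)
      (SimpleFunc.piecewise B hBm (SimpleFunc.const _ 1) (SimpleFunc.const _ 0))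
      (indicatorConstLp p hAm (measure_ne_top _ _) 1), indicatorConstLp_coeFn (p := p) (c := (1 : ℂ))
        (hs := hS) (hμs := measure_ne_top (Measure.infinitePi μ) _),
      (measurePreserving_eval_infinitePi μ k).quasiMeasurePreserving.ae
        (indicatorConstLp_coeFn (p := p) (c := (1 : ℂ)) (hs := hAm)
          (hμs := measure_ne_top (μ k) _))] with x h1 h2 h3
    rw [h1, h2]
    change indicatorConstLp p hAm _ 1 (x k) * _ = _
    rw [h3]
    have hiff : x ∈ (s : Set ι).pi t ↔ x k ∈ A ∧ (splitCoord X k x).1 ∈ B := by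
      simp only [hA, hB, Set.mem_pi, SetLike.mem_coe, Set.mem_ofPred_eq, Finset.mem_subtype]
      constructor
      · exact fun h => ⟨h k, fun j hj => h j hj⟩
      · rintro ⟨h1, h2⟩ j hj
        by_cases hjk : j = k
        · subst hjk
          exact h1 hj
        · exact h2 ⟨j, hjk⟩ hj
    by_cases ha : x k ∈ A <;> by_cases hb : (splitCoord X k x).1 ∈ B <;>
      simp [Set.indicator, SimpleFunc.piecewise_apply, hiff, ha, hb]
  intro f
  have : f ∈ (LinearMap.range (simpleFuncToLp hp
      (measurePreserving_splitCoord μ k))).topologicalClosure := htop ▸ Submodule.mem_top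
  exact this

end infinitePi

/-! ### Factor operators and generators of the algebra -/

namespace UHFData

variable {p : ℝ≥0∞} [Fact (1 ≤ p)] (D : UHFData.{v} p) (hp : p ≠ ∞)

instance : IsProbabilityMeasure D.prodMeasure :=
  inferInstanceAs (IsProbabilityMeasure (Measure.infinitePi D.μ))

instance (n : ℕ) : IsProbabilityMeasure (D.tailMeasure n) :=
  inferInstanceAs (IsProbabilityMeasure (Measure.infinitePi _))

/-- The operator `1 ⊗ ⋯ ⊗ b ⊗ 1 ⊗ ⋯` with `b` acting on the coordinate `k`. -/
noncomputable def factorOp (k : ℕ) : (Lp ℂ p (D.μ k) →L[ℂ] Lp ℂ p (D.μ k)) →ₐ[ℂ]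
    (Lp ℂ p D.prodMeasure →L[ℂ] Lp ℂ p D.prodMeasure) :=
  amplify hp (measurePreserving_splitCoord D.μ k) (denseRange_simpleFuncToLp_splitCoord hp k)

theorem norm_factorOp_apply_le (k : ℕ) (b : Lp ℂ p (D.μ k) →L[ℂ] Lp ℂ p (D.μ k))
    (f : Lp ℂ p D.prodMeasure) : ‖D.factorOp hp k b f‖ ≤ ‖b‖ * ‖f‖ :=
  norm_amplify_apply_le hp _ _ b f

variable {D}

/-- All slots except `k`, together with the tail, are collected into one function `h` of the other
coordinates, reducing to `coeFn_amplify`. -/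
theorem factorOp_elemTensor {n : ℕ} (k : Fin n) (b : Lp ℂ p (D.μ k) →L[ℂ] Lp ℂ p (D.μ k))
    {ξ : ∀ k : Fin n, Lp ℂ p (D.μ k)} {η : Lp ℂ p (D.tailMeasure n)} {f : Lp ℂ p D.prodMeasure}
    (hf : f =ᵐ[D.prodMeasure] D.elemTensor n ξ η) :
    D.factorOp hp k b f =ᵐ[D.prodMeasure] D.elemTensor n (Function.update ξ k (b (ξ k))) η := by
  set h : (∀ j : {j : ℕ // j ≠ k}, D.X j) → ℂ := fun z =>
    (∏ j : {j : Fin n // j ≠ k}, ξ j (z ⟨j, fun h => j.2 (Fin.ext h)⟩)) *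
      η (fun i => z ⟨i, (k.2.trans_le i.2).ne'⟩) with hh
  have hsplit : ∀ ζ x, D.elemTensor n (Function.update ξ k ζ) η x =
      ζ (splitCoord D.X k x).2 * h (splitCoord D.X k x).1 := by
    intro ζ x
    rw [elemTensor, ← Finset.mul_prod_erase _ _ (Finset.mem_univ k), Function.update_self, mul_assoc,
      Finset.prod_subtype (p := fun j => j ≠ k) (Finset.univ.erase k) (by simp)]
    congr 2
    refine Finset.prod_congr rfl fun j _ => ?_
    rw [Function.update_of_ne j.2]
    rfl
  have hm : Measurable h := by
    refine (Finset.measurable_fun_prod _ fun j _ => ?_).mul ?_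
    · exact (Lp.stronglyMeasurable _).measurable.comp (measurable_pi_apply _)
    · exact (Lp.stronglyMeasurable η).measurable.comp
        (measurable_pi_lambda _ fun i => measurable_pi_apply _)
  have hself : ∀ x, D.elemTensor n ξ η x =
      ξ k (splitCoord D.X k x).2 * h (splitCoord D.X k x).1 := fun x => by
    rw [← hsplit, Function.update_eq_self]
  have hd := denseRange_simpleFuncToLp_splitCoord (μ := D.μ) hp k
  exact (coeFn_amplify hp _ hd b hm
    (hf.trans (Eventually.of_forall hself))).trans (Eventually.of_forall fun x => (hsplit _ x).symm)

variable (D) in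
theorem quasiMeasurePreserving_tail (n : ℕ) : Measure.QuasiMeasurePreserving
    (fun (x : ∀ k, D.X k) (k : {k : ℕ // n ≤ k}) => x k) D.prodMeasure (D.tailMeasure n) :=
  MeasurePreserving.quasiMeasurePreserving
    ⟨by fun_prop, Measure.infinitePi_map_restrict' (I := {k | n ≤ k}) D.μ⟩

variable (D) in
/-- Boxes are elementary tensors of indicator functions, of every large length. -/
theorem indicator_box_eq_elemTensor {s : Finset ℕ} {t : ∀ k, Set (D.X k)}
    (ht : ∀ k, MeasurableSet (t k)) (hS : MeasurableSet ((s : Set ℕ).pi t)) (n : ℕ) :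
    ∃ η : Lp ℂ p (D.tailMeasure n),
      indicatorConstLp p hS (measure_ne_top D.prodMeasure _) (1 : ℂ) =ᵐ[D.prodMeasure]
        D.elemTensor n (fun k => indicatorConstLp p (s := {y | (k : ℕ) ∈ s → y ∈ t k})
          (by by_cases h : (k : ℕ) ∈ s <;> simp [h, ht]) (measure_ne_top _ _) 1) η := by
  classical
  set B : Set (∀ k : {k : ℕ // n ≤ k}, D.X k) :=
    ((s.subtype (n ≤ ·) : Finset _) : Set _).pi fun j => t j with hB
  have hBm : MeasurableSet B := MeasurableSet.pi (Finset.countable_toSet _) fun j _ => ht j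
  refine ⟨indicatorConstLp p hBm (measure_ne_top _ _) 1, ?_⟩
  have hcoord : ∀ᵐ x ∂D.prodMeasure, ∀ k : Fin n,
      indicatorConstLp p (s := {y | (k : ℕ) ∈ s → y ∈ t k})
        (by by_cases h : (k : ℕ) ∈ s <;> simp [h, ht]) (measure_ne_top (D.μ k) _) (1 : ℂ) (x k) =
      Set.indicator {y | (k : ℕ) ∈ s → y ∈ t k} (fun _ => 1) (x k) :=
    ae_all_iff.2 fun k => (measurePreserving_eval_infinitePi D.μ k).quasiMeasurePreserving.ae
      (indicatorConstLp_coeFn (p := p))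
  filter_upwards [hcoord, (D.quasiMeasurePreserving_tail n).ae (indicatorConstLp_coeFn (p := p)
    (c := (1 : ℂ)) (hs := hBm) (hμs := measure_ne_top _ _)), indicatorConstLp_coeFn (p := p)
    (c := (1 : ℂ)) (hs := hS) (hμs := measure_ne_top D.prodMeasure _)] with x h1 h2 h3
  rw [h3, elemTensor, h2, Finset.prod_congr rfl fun k _ => h1 k]
  by_cases hx : x ∈ (s : Set ℕ).pi t
  · rw [Set.indicator_of_mem hx, Set.indicator_of_mem (s := B) fun j hj => hx j
      (Finset.mem_subtype.1 hj), mul_one, Finset.prod_eq_one]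
    exact fun k _ => Set.indicator_of_mem (s := {y | (k : ℕ) ∈ s → y ∈ t k}) (hx k) _
  · rw [Set.indicator_of_notMem hx]
    obtain ⟨j, hj, hxj⟩ : ∃ j ∈ s, x j ∉ t j := by
      simpa [Set.mem_pi] using hx
    by_cases hjn : j < n
    · rw [Finset.prod_eq_zero (Finset.mem_univ (⟨j, hjn⟩ : Fin n)), zero_mul]
      exact Set.indicator_of_notMem (s := {y | j ∈ s → y ∈ t j}) (fun h => hxj (h hj)) _
    · rw [Set.indicator_of_notMem (s := B), mul_zero]
      intro h
      exact hxj (h ⟨j, not_lt.1 hjn⟩ (Finset.mem_subtype.2 hj))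

include hp in
/-- Operators on the product that agree on elementary tensors are equal. -/
theorem ext_of_elemTensor {c c' : Lp ℂ p D.prodMeasure →L[ℂ] Lp ℂ p D.prodMeasure} (n : ℕ)
    (h : ∀ ξ η (f : Lp ℂ p D.prodMeasure), f =ᵐ[D.prodMeasure] D.elemTensor n ξ η → c f = c' f) :
    c = c' := by
  have htop : LinearMap.ker (c - c').toLinearMap = ⊤ := by
    refine Lp.eq_top_of_indicatorConstLp_mem hp generateFrom_squareCylinders.symm
      isPiSystem_squareCylinders_measurableSet univ_mem_squareCylinders
      (ContinuousLinearMap.isClosed_ker (c - c')) ?_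
    rintro _ hS ⟨s, t, ht, rfl⟩
    obtain ⟨η, hη⟩ := D.indicator_box_eq_elemTensor (fun j => ht j trivial) hS n
    exact sub_eq_zero.2 (h _ _ _ hη)
  ext1 f
  exact sub_eq_zero.1 (htop ▸ Submodule.mem_top : f ∈ LinearMap.ker (c - c').toLinearMap)

theorem IsTensorOp.unique {n : ℕ} {b : ∀ k : Fin n, Lp ℂ p (D.μ k) →L[ℂ] Lp ℂ p (D.μ k)}
    {c c' : Lp ℂ p D.prodMeasure →L[ℂ] Lp ℂ p D.prodMeasure} (hp : p ≠ ∞)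
    (hc : D.IsTensorOp n b c) (hc' : D.IsTensorOp n b c') : c = c' :=
  ext_of_elemTensor hp n fun ξ η f hf => Lp.ext ((hc ξ η f hf).trans (hc' ξ η f hf).symm)

theorem commute_factorOp {j k : ℕ} (hjk : j ≠ k) (b : Lp ℂ p (D.μ j) →L[ℂ] Lp ℂ p (D.μ j))
    (c : Lp ℂ p (D.μ k) →L[ℂ] Lp ℂ p (D.μ k)) :
    Commute (D.factorOp hp j b) (D.factorOp hp k c) := by
  refine ext_of_elemTensor hp (max j k + 1) fun ξ η f hf => Lp.ext ?_
  let j' : Fin (max j k + 1) := ⟨j, by omega⟩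
  let k' : Fin (max j k + 1) := ⟨k, by omega⟩
  have hjk' : j' ≠ k' := fun h => hjk (congrArg Fin.val h)
  have h1 := factorOp_elemTensor hp j' b (factorOp_elemTensor hp k' c hf)
  have h2 := factorOp_elemTensor hp k' c (factorOp_elemTensor hp j' b hf)
  rw [Function.update_of_ne hjk'] at h1
  rw [Function.update_of_ne hjk'.symm, Function.update_comm hjk'] at h2
  exact h1.trans h2.symm

variable (D) in
/-- The representation of the `k`-th matrix algebra on `L^p(∏ n, X n)`. -/
noncomputable def factorRep (k : ℕ) : Matrix (Fin (D.d k)) (Fin (D.d k)) ℂ →ₐ[ℂ]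
    (Lp ℂ p D.prodMeasure →L[ℂ] Lp ℂ p D.prodMeasure) :=
  (D.factorOp hp k).comp (D.ρ k)

theorem isTensorOp_monomialOp (a : ∀ k, Matrix (Fin (D.d k)) (Fin (D.d k)) ℂ) (n : ℕ) :
    D.IsTensorOp n (fun k => D.ρ k (a k)) (monomialOp (D.factorRep hp) a n) := by
  have key : ∀ m ≤ n, ∀ (ξ : ∀ k : Fin n, Lp ℂ p (D.μ k)) (η : Lp ℂ p (D.tailMeasure n))
      (f : Lp ℂ p D.prodMeasure), f =ᵐ[D.prodMeasure] D.elemTensor n ξ η →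
      monomialOp (D.factorRep hp) a m f =ᵐ[D.prodMeasure]
        D.elemTensor n (fun k => if (k : ℕ) < m then D.ρ k (a k) (ξ k) else ξ k) η := by
    intro m hm
    induction m with
    | zero => exact fun ξ η f hf => by simpa [monomialOp] using hf
    | succ m ih =>
      intro ξ η f hf
      -- The monomial of length `m + 1` applies its last factor first, so the induction hypothesis
      -- is used on the tensor already changed in slot `m`.
      have h := ih (by omega) _ η _ (factorOp_elemTensor hp (⟨m, hm⟩ : Fin n) (D.ρ m (a m)) hf)
      refine h.trans (Eventually.of_forall fun x => ?_)
      refine congrArg (fun ζ => D.elemTensor n ζ η x) (funext fun k => ?_)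
      by_cases hk : k = ⟨m, hm⟩
      · subst hk
        simp
      · have hkm : (k : ℕ) ≠ m := fun h => hk (Fin.ext h)
        have : (k : ℕ) < m + 1 ↔ (k : ℕ) < m := by omega
        simp only [Function.update_of_ne hk, this]
  intro ξ η f hf
  simpa using key n le_rfl ξ η f hf

theorem algebra_eq : D.algebra =
    (Algebra.adjoin ℂ {x | ∃ a n, monomialOp (D.factorRep hp) a n = x}).topologicalClosure := by
  have : {c | ∃ (n : ℕ) (a : ∀ k : Fin n, Matrix (Fin (D.d k)) (Fin (D.d k)) ℂ),
      D.IsTensorOp n (fun k => D.ρ k (a k)) c} =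
      {x | ∃ a n, monomialOp (D.factorRep hp) a n = x} := by
    ext c
    constructor
    · rintro ⟨n, a, hc⟩
      refine ⟨fun k => if h : k < n then a ⟨k, h⟩ else 1, n, IsTensorOp.unique hp ?_ hc⟩
      convert isTensorOp_monomialOp hp _ n using 3 with k
      simp
    · rintro ⟨a, n, rfl⟩
      exact ⟨n, fun k => a k, isTensorOp_monomialOp hp a n⟩
  rw [algebra, this]

end UHFData

/-! ### Restriction to a piece by multiplication with its indicator -/

section indicatorOp

variable {X : Type*} [MeasurableSpace X] {p : ℝ≥0∞} [Fact (1 ≤ p)] {μ : Measure X}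

/-- Multiplication by the indicator function of `s` on `L^p`. -/
noncomputable def indicatorOp {s : Set X} (hs : MeasurableSet s) : Lp ℂ p μ →L[ℂ] Lp ℂ p μ :=
  LinearMap.mkContinuous
    { toFun := fun f => ((Lp.memLp f).indicator hs).toLp
      map_add' := fun f g => by
        refine Eq.trans (MemLp.toLp_congr _ (((Lp.memLp f).indicator hs).add
          ((Lp.memLp g).indicator hs)) ?_) (MemLp.toLp_add _ _)
        filter_upwards [Lp.coeFn_add f g] with x hx
        by_cases h : x ∈ s
        · simp only [Pi.add_apply, Set.indicator_of_mem h, hx]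
        · simp only [Pi.add_apply, Set.indicator_of_notMem h, add_zero]
      map_smul' := fun c f => by
        refine Eq.trans (MemLp.toLp_congr _ (((Lp.memLp f).indicator hs).const_smul c) ?_)
          (MemLp.toLp_const_smul c _)
        filter_upwards [Lp.coeFn_smul c f] with x hx
        by_cases h : x ∈ s <;> simp [h, hx] }
    1 fun f => by
      rw [one_mul]
      refine Lp.norm_le_norm_of_ae_le ?_
      filter_upwards [((Lp.memLp f).indicator hs).coeFn_toLp] with x hx
      change ‖((Lp.memLp f).indicator hs).toLp _ x‖ ≤ _
      rw [hx]
      exact norm_indicator_le_norm_self _ _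

theorem coeFn_indicatorOp {s : Set X} (hs : MeasurableSet s) (f : Lp ℂ p μ) :
    indicatorOp hs f =ᵐ[μ] s.indicator f :=
  ((Lp.memLp f).indicator hs).coeFn_toLp

theorem norm_indicatorOp_apply_le {s : Set X} (hs : MeasurableSet s) (f : Lp ℂ p μ) :
    ‖indicatorOp hs f‖ ≤ ‖f‖ := by
  refine Lp.norm_le_norm_of_ae_le ?_
  filter_upwards [coeFn_indicatorOp hs f] with x hx
  rw [hx]
  exact norm_indicator_le_norm_self _ _

theorem indicatorOp_mem_lpOn {s : Set X} (hs : MeasurableSet s) (f : Lp ℂ p μ) :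
    indicatorOp hs f ∈ lpOn p μ s := by
  change ∀ᵐ x ∂μ, x ∉ s → indicatorOp hs f x = 0
  filter_upwards [coeFn_indicatorOp hs f] with x hx h
  rw [hx, Set.indicator_of_notMem h]

theorem indicatorOp_of_mem_lpOn {s : Set X} (hs : MeasurableSet s) {f : Lp ℂ p μ}
    (hf : f ∈ lpOn p μ s) : indicatorOp hs f = f := by
  refine Lp.ext ?_
  have hf' : ∀ᵐ x ∂μ, x ∉ s → f x = 0 := hf
  filter_upwards [coeFn_indicatorOp hs f, hf'] with x hx h
  rw [hx]
  by_cases hxs : x ∈ s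
  · rw [Set.indicator_of_mem hxs]
  · rw [Set.indicator_of_notMem hxs, h hxs]

omit [Fact (1 ≤ p)] in
theorem indicatorConstLp_mem_lpOn {s t : Set X} (hs : MeasurableSet s) (hμ : μ s ≠ ∞)
    (hst : s ⊆ t) (c : ℂ) : indicatorConstLp p hs hμ c ∈ lpOn p μ t := by
  change ∀ᵐ x ∂μ, x ∉ t → indicatorConstLp p hs hμ c x = 0
  filter_upwards [indicatorConstLp_coeFn_notMem (p := p) (hs := hs) (hμs := hμ) (c := c)] with x hx h
  exact hx fun h' => h (hst h')

/-- The compression of a representation to an invariant subspace `L^p(s)`. -/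
theorem indicatorOp_mul_mul {s : Set X} (hs : MeasurableSet s) {b : Lp ℂ p μ →L[ℂ] Lp ℂ p μ}
    (hb : ∀ f ∈ lpOn p μ s, b f ∈ lpOn p μ s) :
    indicatorOp hs * b * indicatorOp hs = b * indicatorOp hs := by
  ext1 f
  exact indicatorOp_of_mem_lpOn hs (hb _ (indicatorOp_mem_lpOn hs f))

/-- This turns a norm on the restricted space into one for an operator on all of `L^p`, to which
amplification applies. -/
theorem norm_mul_indicatorOp_le {s : Set X} (hs : MeasurableSet s) {B : Type*} [Ring B]
    [Algebra ℂ B] (ρ : B →ₐ[ℂ] (Lp ℂ p μ →L[ℂ] Lp ℂ p μ))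
    (hρ : ∀ a, ∀ f ∈ lpOn p μ s, ρ a f ∈ lpOn p μ s) {a : B}
    (ha : ‖restrictRep ρ (lpOn p μ s) hρ a‖ = 1) : ‖ρ a * indicatorOp hs‖ ≤ 1 := by
  refine ContinuousLinearMap.opNorm_le_bound _ zero_le_one fun f => ?_
  have h := (restrictRep ρ (lpOn p μ s) hρ a).le_opNorm
    ⟨indicatorOp hs f, indicatorOp_mem_lpOn hs f⟩
  rw [ha] at h
  exact h.trans (mul_le_mul_of_nonneg_left (norm_indicatorOp_apply_le hs f) zero_le_one)

end indicatorOp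

/-! ### Box subspaces and the trace on the algebra -/

namespace UHFData

variable {p : ℝ≥0∞} [Fact (1 ≤ p)] (D : UHFData.{v} p) (hp : p ≠ ∞)

/-- The functions on the product that are supported where the first `N` coordinates lie in `Y`. -/
noncomputable def boxSubspace {Y : ∀ k, Set (D.X k)} (hY : ∀ k, MeasurableSet (Y k)) (N : ℕ) :
    Submodule ℂ (Lp ℂ p D.prodMeasure) where
  carrier := {f | ∀ k < N, D.factorOp hp k (indicatorOp (hY k)) f = f}
  zero_mem' := fun k _ => map_zero _
  add_mem' := fun hf hg k hk => by rw [map_add, hf k hk, hg k hk]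
  smul_mem' := fun c f hf k hk => by rw [map_smul, hf k hk]

variable {D} {Y : ∀ k, Set (D.X k)} (hY : ∀ k, MeasurableSet (Y k))

/-- The indicator of the box is a nonzero element, as the box has measure the product of `N`
positive numbers. Constraining all coordinates at once could leave a null set. -/
theorem boxSubspace_ne_bot (hpos : ∀ k, 0 < D.μ k (Y k)) (N : ℕ) :
    D.boxSubspace hp hY N ≠ ⊥ := by
  have hS : MeasurableSet ((Finset.range N : Set ℕ).pi Y) :=
    MeasurableSet.pi (Finset.countable_toSet _) fun k _ => hY k
  refine (Submodule.ne_bot_iff _).2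
    ⟨indicatorConstLp p hS (measure_ne_top D.prodMeasure _) (1 : ℂ), fun k hk => ?_, fun h0 => ?_⟩
  · obtain ⟨η, hη⟩ := D.indicator_box_eq_elemTensor hY hS N
    refine Lp.ext ((factorOp_elemTensor hp (⟨k, hk⟩ : Fin N) _ hη).trans
      (EventuallyEq.trans ?_ hη.symm))
    rw [indicatorOp_of_mem_lpOn, Function.update_eq_self]
    refine indicatorConstLp_mem_lpOn _ _ (t := Y k) ?_ _
    exact fun y (hy : k ∈ Finset.range N → y ∈ Y k) => hy (Finset.mem_range.2 hk)
  · have hprod : D.prodMeasure ((Finset.range N : Set ℕ).pi Y) = 0 := by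
      have h1 := indicatorConstLp_coeFn_mem (p := p) (c := (1 : ℂ)) (hs := hS)
        (hμs := measure_ne_top D.prodMeasure _)
      rw [h0] at h1
      rw [measure_eq_zero_iff_ae_notMem]
      filter_upwards [h1, Lp.coeFn_zero ℂ p D.prodMeasure] with x h2 h3 hx
      exact one_ne_zero ((h2 hx).symm.trans h3)
    rw [prodMeasure, Measure.infinitePi_pi D.μ fun k _ => hY k, Finset.prod_eq_zero_iff] at hprod
    obtain ⟨k, -, hk⟩ := hprod
    exact (hpos k).ne' hk

/-- In coordinate `k` the support condition survives by invariance of the piece; in the others the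
indicator operators commute with `b`. -/
theorem factorOp_apply_mem_boxSubspace {k : ℕ} {b : Lp ℂ p (D.μ k) →L[ℂ] Lp ℂ p (D.μ k)}
    (hb : ∀ f ∈ lpOn p (D.μ k) (Y k), b f ∈ lpOn p (D.μ k) (Y k)) {N : ℕ}
    {f : Lp ℂ p D.prodMeasure} (hf : f ∈ D.boxSubspace hp hY N) :
    D.factorOp hp k b f ∈ D.boxSubspace hp hY N := by
  intro j hj
  by_cases hjk : j = k
  · subst hjk
    have h := congrArg (fun c => D.factorOp hp j c f) (indicatorOp_mul_mul (hY j) hb)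
    simp only [map_mul, mul_apply_eq_comp, hf j hj] at h
    exact h
  · have h := congrArg (fun c => c f) (commute_factorOp hp hjk (indicatorOp (hY j)) b).eq
    exact h.trans (congrArg _ (hf j hj))

theorem norm_factorOp_apply_le_of_mem_boxSubspace {k N : ℕ} (hk : k < N)
    {b : Lp ℂ p (D.μ k) →L[ℂ] Lp ℂ p (D.μ k)} (hb : ‖b * indicatorOp (hY k)‖ ≤ 1)
    {f : Lp ℂ p D.prodMeasure} (hf : f ∈ D.boxSubspace hp hY N) :
    ‖D.factorOp hp k b f‖ ≤ ‖f‖ := by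
  have h : D.factorOp hp k (b * indicatorOp (hY k)) f = D.factorOp hp k b f := by
    rw [map_mul]
    exact congrArg _ (hf k hk)
  rw [← h]
  exact (D.norm_factorOp_apply_le hp k _ f).trans
    (mul_le_of_le_one_left (norm_nonneg f) hb)

/-- The algebra `A(d, ρ)` has a unique continuous normalised trace, and it is contractive. -/
theorem existsUnique_trace_algebra (hp : p ≠ ∞) (hD : ∀ n, LocallyHasEnoughIsometries (D.ρ n)) :
    ∃ τ : D.algebra →L[ℂ] ℂ, (τ 1 = 1 ∧ ∀ a b : D.algebra, τ (b * a) = τ (a * b)) ∧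
      (∀ a, ‖τ a‖ ≤ ‖a‖) ∧ ∀ τ' : D.algebra →L[ℂ] ℂ,
        (τ' 1 = 1 ∧ ∀ a b : D.algebra, τ' (b * a) = τ' (a * b)) → τ' = τ := by
  have hloc : ∀ n, ∃ (Y : Set (D.X n)) (_ : MeasurableSet Y) (_ : 0 < D.μ n Y)
      (hV : ∀ a, ∀ f ∈ lpOn p (D.μ n) Y, D.ρ n a f ∈ lpOn p (D.μ n) Y),
      HasEnoughIsometries (restrictRep (D.ρ n) (lpOn p (D.μ n) Y) hV) := by
    intro n
    obtain ⟨ι, Y, -, hY, hpos, -, hU, h⟩ := hD n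
    -- The space is nonempty, so the partition has a piece; any single one suffices.
    obtain ⟨x⟩ := nonempty_of_isProbabilityMeasure (D.μ n)
    obtain ⟨i, -⟩ := Set.mem_iUnion.1 (hU.symm ▸ Set.mem_univ x : x ∈ ⋃ i, Y i)
    obtain ⟨hV, hi⟩ := h i
    exact ⟨Y i, hY i, hpos i, hV, hi⟩
  choose Y hY hpos hV hiso using hloc
  choose G hfin hirr hnorm using hiso
  have (k : ℕ) : Fintype (G k) := @Fintype.ofFinite _ (hfin k)
  exact existsUnique_trace (r := D.factorRep hp) (G := G) (V := D.boxSubspace hp hY)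
    (fun k => (zero_lt_two.trans_le (D.two_le_d k)).ne') hirr
    (fun j k hjk a b => commute_factorOp hp hjk _ _) (boxSubspace_ne_bot hp hY hpos)
    (fun N k _ a v hv => factorOp_apply_mem_boxSubspace hp hY (hV k a) hv)
    (fun N k hk g hg v hv => norm_factorOp_apply_le_of_mem_boxSubspace hp hY hk
      (norm_mul_indicatorOp_le (hY k) _ (hV k) (hnorm k g hg)) hv)
    (algebra_eq hp)

end UHFData

/-! ### Transfer along an isometric isomorphism -/

/-- Transfer of the unique normalised trace along an isometric isomorphism. -/
theorem existsUnique_trace_of_isometric {A B : Type*} [NormedRing A] [NormedAlgebra ℂ A]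
    [NormedRing B] [NormedAlgebra ℂ B] (e : A ≃ₐ[ℂ] B) (he : ∀ a, ‖e a‖ = ‖a‖) (hA : ‖(1 : A)‖ ≤ 1)
    (hB : ∃ τ : B →L[ℂ] ℂ, (τ 1 = 1 ∧ ∀ a b : B, τ (b * a) = τ (a * b)) ∧ (∀ a, ‖τ a‖ ≤ ‖a‖) ∧
      ∀ τ' : B →L[ℂ] ℂ, (τ' 1 = 1 ∧ ∀ a b : B, τ' (b * a) = τ' (a * b)) → τ' = τ) :
    (∃! τ : A →L[ℂ] ℂ, τ 1 = 1 ∧ ∀ a b : A, τ (b * a) = τ (a * b)) ∧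
      ∀ τ : A →L[ℂ] ℂ, (τ 1 = 1 ∧ ∀ a b : A, τ (b * a) = τ (a * b)) → ‖τ‖ = 1 := by
  obtain ⟨τ, ⟨hτ1, hτ⟩, hle, huniq⟩ := hB
  let E : A ≃ₗᵢ[ℂ] B := ⟨e.toLinearEquiv, he⟩
  let σ : A →L[ℂ] ℂ := τ.comp E.toContinuousLinearEquiv.toContinuousLinearMap
  have hσ : ∀ a, σ a = τ (e a) := fun a => rfl
  have hσu : ∀ σ' : A →L[ℂ] ℂ, (σ' 1 = 1 ∧ ∀ a b : A, σ' (b * a) = σ' (a * b)) → σ' = σ := by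
    intro σ' ⟨h1, h2⟩
    have happ : ∀ b, σ'.comp E.symm.toContinuousLinearEquiv.toContinuousLinearMap b =
      σ' (e.symm b) := fun b => rfl
    have h3 := huniq (σ'.comp E.symm.toContinuousLinearEquiv.toContinuousLinearMap)
      ⟨by rw [happ, map_one, h1], fun a b => by rw [happ, happ, map_mul e.symm, map_mul e.symm, h2]⟩
    ext a
    rw [hσ, ← h3, happ, e.symm_apply_apply]
  refine ⟨⟨σ, ⟨by rw [hσ, map_one, hτ1], fun a b => by rw [hσ, hσ, map_mul e, map_mul e, hτ]⟩, hσu⟩,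
    fun σ' hσ' => le_antisymm (σ'.opNorm_le_bound zero_le_one fun a => ?_) ?_⟩
  · rw [hσu σ' hσ', hσ, one_mul]
    exact (hle _).trans_eq (he a)
  · have h1 := σ'.le_opNorm 1
    rw [hσ'.1, norm_one] at h1
    exact h1.trans (mul_le_of_le_one_right (norm_nonneg _) hA)

theorem corollaryC {p : ℝ≥0∞} [Fact (1 ≤ p)] (hp : p ≠ ∞) {X : Type u} [MeasurableSpace X]
    {μ : Measure X} [SigmaFinite μ] (A : Subalgebra ℂ (Lp ℂ p μ →L[ℂ] Lp ℂ p μ))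
    (hA : IsUHFTensorTypeLocallyEnoughIsometries.{u, v} A) :
    (∃! τ : A →L[ℂ] ℂ, τ 1 = 1 ∧ ∀ a b : A, τ (b * a) = τ (a * b)) ∧
      ∀ τ : A →L[ℂ] ℂ, (τ 1 = 1 ∧ ∀ a b : A, τ (b * a) = τ (a * b)) → ‖τ‖ = 1 := by
  obtain ⟨D, ⟨e, he⟩, hD⟩ := hA
  exact existsUnique_trace_of_isometric e he ContinuousLinearMap.norm_id_le
    (UHFData.existsUnique_trace_algebra hp hD)
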